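/- Let $\mathbb{E}$ be a three-dimensional Euclidean space in the sense of synthetic geometry: a set of points with straight lines, planes, a betweenness relation, and congruence relations for segments and angles, satisfying the axioms of incidence, order, congruence, continuity (the axioms of Archimedes and Cantor) and parallels. Fix a reference segment $[IJ]$, $I\neq J$, and let $|AB|$ denote the length of $[AB]$ measured relative to $[IJ]$: the value of the unique function that is positive on segments, equals $1$ on $[IJ]$, takes equal values on congruent segments, and satisfies $|AC|=|AB|+|BC|$ whenever $B$ lies between $A$ and $C$; put $|AA|=0$. For a point $O$ and a real number $k$, let $f=h_{kO}\colon\mathbb{E}\to\mathbb{E}$ be the homothety with centre $O$ and factor $k$: $f(O)=O$, and for $X\neq O$ the point $f(X)=Y$ is the point of the line $OX$ with $\overrightarrow{OY}=k\cdot\overrightarrow{OX}$, that is, $|OY|=|k|\cdot|OX|$, where $\overrightarrow{OY}$ is codirected with $\overrightarrow{OX}$ if $k>0$, oppositely directed if $k<0$, and $Y=O$ if $k=0$. Then for any two points $X$ and $Y$ $$|f(X)f(Y)|=|k|\cdot|XY|,$$ and, if $k\neq 0$ and $X\neq Y$, then $f(X)\neq f(Y)$ and the line connecting $f(X)$ and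 $f(Y)$ is parallel to the line connecting $X$ and $Y$. (Two lines are parallel if they coincide or if they lie on one plane and do not intersect.) -/

import Mathlib

/-- The primitive notions of synthetic space geometry on a set `E` of points: which sets of points
are straight lines, which are planes, the ternary relation `Btw A B C` (`B` lies between `A` and
`C`), and the congruence relations for segments and for angles. Segments and angles are the sets of
points defined below; the values of `SegCong` and `AngCong` on other sets play no role. -/
structure SyntheticGeometry (E : Type*) where
  lines : Set (Set E)
  planes : Set (Set E)
  Btw : E → E → E → Prop
  SegCong : Set E → Set E → Prop
  AngCong : Set E → Set E → Prop

namespace SyntheticGeometry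

variable {E : Type*} (G : SyntheticGeometry E)

/-- The three points lie on one straight line. -/
def Collin (A B C : E) : Prop := ∃ a ∈ G.lines, A ∈ a ∧ B ∈ a ∧ C ∈ a

/-- The straight line `AB` (used for `A ≠ B`, when there is exactly one line through `A`, `B`). -/
def line (A B : E) : Set E := {X | ∃ a ∈ G.lines, A ∈ a ∧ B ∈ a ∧ X ∈ a}

/-- The plane `ABC` (used for non-collinear `A`, `B`, `C`, when there is exactly one such plane). -/
def plane (A B C : E) : Set E := {X | ∃ α ∈ G.planes, A ∈ α ∧ B ∈ α ∧ C ∈ α ∧ X ∈ α}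

/-- The closed segment `[AB]` (used for `A ≠ B`). -/
def seg (A B : E) : Set E := {X | X = A ∨ X = B ∨ G.Btw A X B}

/-- The closed ray `[OA⟩` with origin `O` passing through `A ≠ O`. -/
def ray (O A : E) : Set E := {X | X = O ∨ X = A ∨ G.Btw O X A ∨ G.Btw O A X}

/-- The open half-plane of the plane `α`, bounded by the line `a` and containing the point `B`
of `α` off `a`: the points of `α` off `a` that `a` does not separate from `B`. -/
def openHalfPlane (α a : Set E) (B : E) : Set E :=
  {X | X ∈ α ∧ X ∉ a ∧ (X = B ∨ ∀ Z ∈ G.seg X B, Z ∉ a)}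

/-- The closed half-plane: the open one together with its boundary line. -/
def closedHalfPlane (α a : Set E) (B : E) : Set E := G.openHalfPlane α a B ∪ a

/-- The angle `∠AOB` with vertex `O` (used for non-collinear `A`, `O`, `B`), as a set of points:
the intersection of the closed half-plane bounded by `OA` that contains `B` with the closed
half-plane bounded by `OB` that contains `A`. -/
def angle (A O B : E) : Set E :=
  G.closedHalfPlane (G.plane A O B) (G.line O A) B ∩
    G.closedHalfPlane (G.plane A O B) (G.line O B) A

/-- `[AB] < [CD]`: some interior point `F` of `[CD]` satisfies `[AB] ≅ [CF]`. -/
def SegLt (A B C D : E) : Prop := ∃ F, G.Btw C F D ∧ G.SegCong (G.seg A B) (G.seg C F)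

/-- `[CD] ≅ n · [IJ]`: the segment `[CD]` is laid out as `n` consecutive replicas of `[IJ]`. -/
def IsReplicaSum (n : ℕ) (I J C D : E) : Prop :=
  ∃ P : ℕ → E, P 0 = C ∧ P n = D ∧
    (∀ i, i < n → P i ≠ P (i + 1) ∧ G.SegCong (G.seg (P i) (P (i + 1))) (G.seg I J)) ∧
    (∀ i, i + 2 ≤ n → G.Btw (P i) (P (i + 1)) (P (i + 2)))

/-- Two straight lines are parallel if they coincide, or lie on one plane and do not intersect. -/
def Parallel (a b : Set E) : Prop :=
  a = b ∨ ((∃ α ∈ G.planes, a ⊆ α ∧ b ⊆ α) ∧ a ∩ b = ∅)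

/-- The axioms of (three-dimensional) Euclidean geometry. -/
structure IsEuclidean : Prop where
  -- Axioms of incidence.
  /-- Each line contains at least two points. -/
  line_two_points : ∀ a ∈ G.lines, ∃ A B, A ≠ B ∧ A ∈ a ∧ B ∈ a
  /-- Exactly one line passes through two distinct points. -/
  existsUnique_line : ∀ A B, A ≠ B → ∃! a, a ∈ G.lines ∧ A ∈ a ∧ B ∈ a
  /-- There are three points not lying on one line. -/
  exists_not_collin : ∃ A B C, A ≠ B ∧ A ≠ C ∧ B ≠ C ∧ ¬ G.Collin A B C
  /-- Exactly one plane passes through three points not lying on one line. -/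
  existsUnique_plane : ∀ A B C, ¬ G.Collin A B C →
    ∃! α, α ∈ G.planes ∧ A ∈ α ∧ B ∈ α ∧ C ∈ α
  /-- Each plane contains at least one point. -/
  plane_nonempty : ∀ α ∈ G.planes, ∃ A, A ∈ α
  /-- A line two distinct points of which lie on a plane lies on this plane. -/
  line_subset_plane : ∀ a ∈ G.lines, ∀ α ∈ G.planes, ∀ A B, A ≠ B →
    A ∈ a → B ∈ a → A ∈ α → B ∈ α → a ⊆ α
  /-- Two intersecting planes have at least two common points. -/
  plane_inter : ∀ α ∈ G.planes, ∀ β ∈ G.planes, (α ∩ β).Nonempty →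
    ∃ A B, A ≠ B ∧ A ∈ α ∩ β ∧ B ∈ α ∩ β
  /-- There are four points not lying on one plane. -/
  exists_not_coplanar : ∃ A B C D, A ≠ B ∧ A ≠ C ∧ A ≠ D ∧ B ≠ C ∧ B ≠ D ∧ C ≠ D ∧
    ¬ ∃ α ∈ G.planes, A ∈ α ∧ B ∈ α ∧ C ∈ α ∧ D ∈ α
  -- Axioms of order.
  /-- Betweenness is a relation among distinct points of one line. -/
  btw_points : ∀ A B C, G.Btw A B C → A ≠ B ∧ A ≠ C ∧ B ≠ C ∧ G.Collin A B C
  btw_symm : ∀ A B C, G.Btw A B C → G.Btw C B A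
  /-- Each segment can be extended. -/
  btw_extend : ∀ A B, A ≠ B → ∃ C, G.Btw A B C
  /-- Of three points, only one can lie between the two others. -/
  btw_unique : ∀ A B C, G.Btw A B C → ¬ G.Btw B C A ∧ ¬ G.Btw C A B
  /-- Pasch's axiom. -/
  pasch : ∀ α ∈ G.planes, ∀ A ∈ α, ∀ B ∈ α, ∀ C ∈ α, ¬ G.Collin A B C →
    ∀ a ∈ G.lines, a ⊆ α → A ∉ a → B ∉ a → C ∉ a →
    (∃ X ∈ a, G.Btw A X B) → (∃ X ∈ a, G.Btw A X C) ∨ (∃ X ∈ a, G.Btw B X C)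
  -- Axioms of congruence.
  segCong_refl : ∀ A B, A ≠ B → G.SegCong (G.seg A B) (G.seg A B)
  /-- A given segment can be laid off on a given ray, in exactly one way. -/
  seg_transfer : ∀ A B C Q, A ≠ B → C ≠ Q →
    ∃! D, D ∈ G.ray C Q ∧ D ≠ C ∧ G.SegCong (G.seg A B) (G.seg C D)
  segCong_trans : ∀ A B C D K L, A ≠ B → C ≠ D → K ≠ L →
    G.SegCong (G.seg A B) (G.seg C D) → G.SegCong (G.seg C D) (G.seg K L) →
    G.SegCong (G.seg A B) (G.seg K L)
  /-- Sums of congruent segments are congruent. -/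
  seg_add : ∀ A B C K L M, G.Btw A B C → G.Btw K L M →
    G.SegCong (G.seg A B) (G.seg K L) → G.SegCong (G.seg B C) (G.seg L M) →
    G.SegCong (G.seg A C) (G.seg K M)
  /-- Differences of congruent segments are congruent. -/
  seg_sub : ∀ A B C K L M, G.Btw A B C → G.Btw K L M →
    G.SegCong (G.seg A B) (G.seg K L) → G.SegCong (G.seg A C) (G.seg K M) →
    G.SegCong (G.seg B C) (G.seg L M)
  angCong_refl : ∀ A O B, ¬ G.Collin A O B → G.AngCong (G.angle A O B) (G.angle A O B)
  /-- A given angle can be laid off from a given ray `[QM⟩` into a given half-plane bounded by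
  the line `QM`, in exactly one way. -/
  angle_transfer : ∀ A O B M Q P, ¬ G.Collin A O B → ¬ G.Collin M Q P →
    ∃! n : Set E, ∃ N, N ∈ G.openHalfPlane (G.plane M Q P) (G.line Q M) P ∧ n = G.ray Q N ∧
      G.AngCong (G.angle A O B) (G.angle M Q N)
  /-- Two triangles with two sides and the angle between them congruent have the other angles
  congruent. -/
  side_angle_side : ∀ A B C A' B' C', ¬ G.Collin A B C → ¬ G.Collin A' B' C' →
    G.SegCong (G.seg A B) (G.seg A' B') → G.SegCong (G.seg A C) (G.seg A' C') →
    G.AngCong (G.angle B A C) (G.angle B' A' C') →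
    G.AngCong (G.angle A B C) (G.angle A' B' C') ∧
      G.AngCong (G.angle A C B) (G.angle A' C' B')
  -- Axioms of continuity.
  /-- The axiom of Archimedes. -/
  archimedes : ∀ A B I J, A ≠ B → I ≠ J →
    ∃ n : ℕ, 0 < n ∧ ∃ C D, G.IsReplicaSum n I J C D ∧ G.SegLt A B C D
  /-- Cantor's axiom: nested segments on a line have a common point. -/
  cantor : ∀ a ∈ G.lines, ∀ A B : ℕ → E, (∀ n, A n ≠ B n ∧ A n ∈ a ∧ B n ∈ a) →
    (∀ n, G.seg (A (n + 1)) (B (n + 1)) ⊆ G.seg (A n) (B n)) →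
    ∃ X, ∀ n, X ∈ G.seg (A n) (B n)
  -- Axiom of parallels.
  existsUnique_parallel : ∀ a ∈ G.lines, ∀ O, O ∉ a →
    ∃! b, b ∈ G.lines ∧ O ∈ b ∧ G.Parallel b a

/-- `l` is a length function with the reference (unit) segment `[IJ]`: it is positive on segments,
equal to `1` on `[IJ]`, takes equal values on congruent segments and is additive. A degenerate
segment is given the length `0`. -/
structure IsLengthFunction (I J : E) (l : E → E → ℝ) : Prop where
  degenerate : ∀ A, l A A = 0
  pos : ∀ A B, A ≠ B → 0 < l A B
  unit : l I J = 1
  congr : ∀ A B C D, A ≠ B → C ≠ D → G.SegCong (G.seg A B) (G.seg C D) → l A B = l C D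
  add : ∀ A B C, G.Btw A B C → l A C = l A B + l B C

/-- The length `|AB|` measured relative to the reference segment `[IJ]`, `I ≠ J`: the value at
`A`, `B` of the length function with this reference segment (in Euclidean geometry there is exactly
one). -/
noncomputable def length (I J : E) : E → E → ℝ := Classical.epsilon (G.IsLengthFunction I J)

/-- The vector `OY` is the product `k · OX` of the vector `OX`, `X ≠ O`, by the number `k`: it lies
on the line `OX`, its length is `|k| · |OX|`, and it is codirected with `OX` (that is, `Y` is on the
ray `[OX⟩`) for `k > 0`, oppositely directed to `OX` (that is, `O` lies between `X` and `Y`) for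
`k < 0`, and the zero vector for `k = 0`. Lengths are measured relative to `[IJ]`. -/
def IsScalarMul (I J : E) (k : ℝ) (O X Y : E) : Prop :=
  Y ∈ G.line O X ∧ G.length I J O Y = |k| * G.length I J O X ∧
    (0 < k → Y ∈ G.ray O X) ∧ (k < 0 → G.Btw X O Y) ∧ (k = 0 → Y = O)

open Classical in
/-- The homothety of the space with centre `O` and factor `k`: it fixes `O` and takes a point
`X ≠ O` to the point `Y` with `OY = k · OX` (in Euclidean geometry there is exactly one). -/
noncomputable def homothety (I J : E) (k : ℝ) (O X : E) : E :=
  if X = O then O else @Classical.epsilon E ⟨O⟩ (fun Y => G.IsScalarMul I J k O X Y)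

end SyntheticGeometry

/-! ### Incidence of points, lines and planes -/

namespace SyntheticGeometry
variable {E : Type*} {G : SyntheticGeometry E}

/-! Every line `OX` has an affine parametrization by the real numbers with parameter 0 at `O` and 1
at `X` (`IsParam`), in which the homothety with centre `O` is multiplication of the parameter by
`k`. If `O`, `X`, `Y` are collinear, both assertions can be read off from it. Otherwise they are
Thales' theorem (`thales`) and its metric form (`thales_length`) for the triangle `OXY`.

Parametrizations require lengths. Congruence classes of segments form an Archimedean ordered
cancellative monoid with subtraction, which embeds into `ℝ` by Hölder's theorem. This yields a
length function (`exists_isLengthFunction`), and whatever function `length` picks will do, since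
uniqueness is never used. Its values are dense because segments have interior points, and Cantor's
axiom then makes every positive real a length (`exists_eq`), hence every line a copy of `ℝ`
(`exists_ruler`).

For Thales, parallels to `XY` carry the parameter `s` on `OX` to a parameter `g s` on `OY`. The
midline theorem (`midline`) gives `g` Jensen's equation, hence additivity. Plane separation makes
`g` positive on positive numbers, and `g 1 = 1`, so `g` is the identity. The midline theorem rests
on point reflections, which preserve lengths and map lines that miss the centre to parallels, by
side-angle-side, congruence of vertical angles and uniqueness of laying off angles. The metric form
follows from Thales applied at a second vertex and the congruence of opposite sides of a
parallelogram. -/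

theorem line_comm (P Q : E) : G.line P Q = G.line Q P := by
  ext X
  exact ⟨fun ⟨a, h, h1, h2, h3⟩ => ⟨a, h, h2, h1, h3⟩,
    fun ⟨a, h, h1, h2, h3⟩ => ⟨a, h, h2, h1, h3⟩⟩

namespace IsEuclidean

theorem line_unique (hG : G.IsEuclidean) {a b : Set E} (ha : a ∈ G.lines) (hb : b ∈ G.lines)
    {P Q : E} (hPQ : P ≠ Q) (hPa : P ∈ a) (hQa : Q ∈ a) (hPb : P ∈ b) (hQb : Q ∈ b) : a = b :=
  (hG.existsUnique_line P Q hPQ).unique ⟨ha, hPa, hQa⟩ ⟨hb, hPb, hQb⟩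

theorem line_meet (hG : G.IsEuclidean) {a b : Set E} (ha : a ∈ G.lines) (hb : b ∈ G.lines)
    {P Q : E} (hPa : P ∈ a) (hPb : P ∈ b) (hQa : Q ∈ a) (hQb : Q ∈ b) : P = Q ∨ a = b :=
  or_iff_not_imp_left.2 fun h => hG.line_unique ha hb h hPa hQa hPb hQb

grind_pattern line_meet => a ∈ G.lines, b ∈ G.lines, P ∈ a, P ∈ b, Q ∈ a, Q ∈ b

theorem exists_ne (hG : G.IsEuclidean) (P : E) : ∃ Q, P ≠ Q := by
  obtain ⟨A, B, C, h, -⟩ := hG.exists_not_collin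
  by_cases hA : P = A
  · exact ⟨B, hA ▸ h⟩
  · exact ⟨A, hA⟩

theorem exists_line (hG : G.IsEuclidean) (P Q : E) : ∃ a ∈ G.lines, P ∈ a ∧ Q ∈ a := by
  by_cases h : P = Q
  · obtain ⟨R, hR⟩ := hG.exists_ne P
    obtain ⟨a, ⟨ha, h1, -⟩, -⟩ := hG.existsUnique_line P R hR
    exact ⟨a, ha, h1, h ▸ h1⟩
  · obtain ⟨a, ⟨ha, h1, h2⟩, -⟩ := hG.existsUnique_line P Q h
    exact ⟨a, ha, h1, h2⟩

theorem line_eq (hG : G.IsEuclidean) {a : Set E} (ha : a ∈ G.lines) {P Q : E} (hPQ : P ≠ Q)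
    (hP : P ∈ a) (hQ : Q ∈ a) : G.line P Q = a := by
  ext X
  constructor
  · rintro ⟨b, hb, h1, h2, h3⟩
    rwa [hG.line_unique ha hb hPQ hP hQ h1 h2]
  · exact fun h => ⟨a, ha, hP, hQ, h⟩

theorem line_mem (hG : G.IsEuclidean) {P Q : E} (hPQ : P ≠ Q) : G.line P Q ∈ G.lines := by
  obtain ⟨a, ha, h1, h2⟩ := hG.exists_line P Q
  rwa [hG.line_eq ha hPQ h1 h2]

theorem left_mem_line (hG : G.IsEuclidean) (P Q : E) : P ∈ G.line P Q := by
  obtain ⟨a, ha, h1, h2⟩ := hG.exists_line P Q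
  exact ⟨a, ha, h1, h2, h1⟩

theorem right_mem_line (hG : G.IsEuclidean) (P Q : E) : Q ∈ G.line P Q := by
  obtain ⟨a, ha, h1, h2⟩ := hG.exists_line P Q
  exact ⟨a, ha, h1, h2, h2⟩

theorem exists_not_mem (hG : G.IsEuclidean) {a : Set E} (ha : a ∈ G.lines) : ∃ P, P ∉ a := by
  obtain ⟨A, B, C, -, -, -, h⟩ := hG.exists_not_collin
  by_contra! hc
  exact h ⟨a, ha, hc A, hc B, hc C⟩

theorem not_collin (hG : G.IsEuclidean) {a : Set E} (ha : a ∈ G.lines) {A B C : E} (hAB : A ≠ B)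
    (hA : A ∈ a) (hB : B ∈ a) (hC : C ∉ a) : ¬ G.Collin A B C := by
  rintro ⟨b, hb, h1, h2, h3⟩
  exact hC (hG.line_unique ha hb hAB hA hB h1 h2 ▸ h3)

theorem exists_plane (hG : G.IsEuclidean) {a : Set E} (ha : a ∈ G.lines) {P : E} (hP : P ∉ a) :
    ∃ α ∈ G.planes, a ⊆ α ∧ P ∈ α := by
  obtain ⟨A, B, h, hA, hB⟩ := hG.line_two_points a ha
  obtain ⟨α, ⟨hα, h1, h2, h3⟩, -⟩ := hG.existsUnique_plane A B P (hG.not_collin ha h hA hB hP)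
  exact ⟨α, hα, hG.line_subset_plane a ha α hα A B h hA hB h1 h2, h3⟩

/-! ### Order on a line, from Pasch's axiom -/

theorem btw_ne (hG : G.IsEuclidean) {A B C : E} (h : G.Btw A B C) : A ≠ B ∧ A ≠ C ∧ B ≠ C :=
  ⟨(hG.btw_points A B C h).1, (hG.btw_points A B C h).2.1, (hG.btw_points A B C h).2.2.1⟩

theorem btw_line (hG : G.IsEuclidean) {A B C : E} (h : G.Btw A B C) :
    ∃ a ∈ G.lines, A ∈ a ∧ B ∈ a ∧ C ∈ a := (hG.btw_points A B C h).2.2.2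

theorem mem_mid (hG : G.IsEuclidean) {A B C : E} (h : G.Btw A B C) {a : Set E} (ha : a ∈ G.lines)
    (hA : A ∈ a) (hC : C ∈ a) : B ∈ a := by
  obtain ⟨b, hb, h1, h2, h3⟩ := hG.btw_line h
  rwa [hG.line_unique ha hb (hG.btw_ne h).2.1 hA hC h1 h3]

theorem mem_right (hG : G.IsEuclidean) {A B C : E} (h : G.Btw A B C) {a : Set E}
    (ha : a ∈ G.lines) (hA : A ∈ a) (hB : B ∈ a) : C ∈ a := by
  obtain ⟨b, hb, h1, h2, h3⟩ := hG.btw_line h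
  rwa [hG.line_unique ha hb (hG.btw_ne h).1 hA hB h1 h2]

theorem line_subset (hG : G.IsEuclidean) {α : Set E} (hα : α ∈ G.planes) {A B : E} (hAB : A ≠ B)
    (hA : A ∈ α) (hB : B ∈ α) : G.line A B ⊆ α :=
  hG.line_subset_plane _ (hG.line_mem hAB) α hα A B hAB (hG.left_mem_line A B)
    (hG.right_mem_line A B) hA hB

theorem mem_plane_mid (hG : G.IsEuclidean) {A B C : E} (h : G.Btw A B C) {α : Set E}
    (hα : α ∈ G.planes) (hA : A ∈ α) (hC : C ∈ α) : B ∈ α :=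
  hG.line_subset hα (hG.btw_ne h).2.1 hA hC (hG.mem_mid h (hG.line_mem (hG.btw_ne h).2.1)
    (hG.left_mem_line _ _) (hG.right_mem_line _ _))

theorem mem_plane_right (hG : G.IsEuclidean) {A B C : E} (h : G.Btw A B C) {α : Set E}
    (hα : α ∈ G.planes) (hA : A ∈ α) (hB : B ∈ α) : C ∈ α :=
  hG.line_subset hα (hG.btw_ne h).1 hA hB (hG.mem_right h (hG.line_mem (hG.btw_ne h).1)
    (hG.left_mem_line _ _) (hG.right_mem_line _ _))

/-- Pasch's axiom for the line `c` through `X` and `P`, where the side line `b` avoids `P`. -/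
theorem pasch_line (hG : G.IsEuclidean) {α b c : Set E} (hα : α ∈ G.planes) (hb : b ∈ G.lines)
    (hc : c ∈ G.lines) (hbα : b ⊆ α) {A B C X : E} (P : E) (hA : A ∈ b) (hB : B ∈ b) (hC : C ∈ α)
    (hCb : C ∉ b) (hX : G.Btw A X B) (hXc : X ∈ c) (hPc : P ∈ c) (hP : P ∈ α) (hPb : P ∉ b)
    (hCc : C ∉ c) : (∃ Y ∈ c, G.Btw A Y C) ∨ (∃ Y ∈ c, G.Btw B Y C) := by
  have hXb := hG.mem_mid hX hb hA hB
  have hPX : P ≠ X := fun h => hPb (h ▸ hXb)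
  have ne := hG.btw_ne hX
  -- Since `c` contains `P` off `b`, it meets `b` only in `X`, so `A` and `B` are off `c`, as
  -- Pasch's axiom demands.
  have key : ∀ Z ∈ b, Z ≠ X → Z ∉ c := fun Z hZ hZX h =>
    hPb (hG.line_unique hc hb hZX h hXc hZ hXb ▸ hPc)
  exact hG.pasch α hα A (hbα hA) B (hbα hB) C hC (hG.not_collin hb ne.2.1 hA hB hCb) _
    hc (hG.line_subset_plane c hc α hα P X hPX hPc hXc hP (hbα hXb)) (key A hA ne.1)
    (key B hB ne.2.2.symm) hCc ⟨X, hXc, hX⟩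

/-- Take `F` beyond `P` on `AP` and `Q` beyond `C` on `FC`. The line `QP` enters the triangle `AFC`
at `P`. It meets the line `FC` only at `Q`, outside the side, so it leaves through `AC`. -/
theorem exists_btw (hG : G.IsEuclidean) {A C : E} (hAC : A ≠ C) : ∃ B, G.Btw A B C := by
  obtain ⟨e, he, hAe, hCe⟩ := hG.exists_line A C
  obtain ⟨P, hP⟩ := hG.exists_not_mem he
  have hAP : A ≠ P := fun h => hP (h ▸ hAe)
  obtain ⟨α, hα, heα, hPα⟩ := hG.exists_plane he hP
  obtain ⟨F, hF⟩ := hG.btw_extend A P hAP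
  obtain ⟨b, hb, hAb, hPb, hFb⟩ := hG.btw_line hF
  have hbα : b ⊆ α := hG.line_subset_plane b hb α hα A P hAP hAb hPb (heα hAe) hPα
  have hCb : C ∉ b := fun h => hP (hG.line_unique he hb hAC hAe hCe hAb h ▸ hPb)
  have hFC : F ≠ C := fun h => hCb (h ▸ hFb)
  obtain ⟨Q, hQ⟩ := hG.btw_extend F C hFC
  obtain ⟨d, hd, hFd, hCd, hQd⟩ := hG.btw_line hQ
  obtain ⟨c, hc, hQc, hPc⟩ := hG.exists_line Q P
  have ne := hG.btw_ne hF
  have ne' := hG.btw_ne hQ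
  have hQb : Q ∉ b := by grind
  have hQP : Q ≠ P := by grind
  rcases hG.pasch_line hα hb hc hbα Q hAb hFb (heα hCe) hCb hF hPc hQc
    (hG.mem_plane_right hQ hα (hbα hFb) (heα hCe)) hQb (by grind) with ⟨Y, hY, h⟩ | ⟨Y, hY, h⟩
  · exact ⟨Y, h⟩
  · exfalso
    have := hG.mem_mid h hd hFd hCd
    have : Y = Q := by grind
    subst this
    exact (hG.btw_unique _ _ _ hQ).1 (hG.btw_symm _ _ _ h)

/-- Pasch is applied four times. With `Q` beyond `P` on `BP`, the two negated hypotheses force `AP`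
to meet `QC` inside at `Y` and `CP` to meet `QA` inside at `F`. In the triangle `QAY` the line `CP`
then shows that `P` is between `A` and `Y`, and in `AYC` the line `BQ` leaves through `B`. -/
theorem btw_of_not (hG : G.IsEuclidean) {a : Set E} (ha : a ∈ G.lines) {A B C : E} (hAB : A ≠ B)
    (hAC : A ≠ C) (hBC : B ≠ C) (hA : A ∈ a) (hB : B ∈ a) (hC : C ∈ a) (h1 : ¬ G.Btw B A C)
    (h2 : ¬ G.Btw B C A) : G.Btw A B C := by
  obtain ⟨P, hP⟩ := hG.exists_not_mem ha
  have hBP : B ≠ P := fun h => hP (h ▸ hB)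
  obtain ⟨α, hα, haα, hPα⟩ := hG.exists_plane ha hP
  obtain ⟨Q, hQ⟩ := hG.btw_extend B P hBP
  obtain ⟨b, hb, hBb, hPb, hQb⟩ := hG.btw_line hQ
  have hbα : b ⊆ α := hG.line_subset_plane b hb α hα B P hBP hBb hPb (haα hB) hPα
  obtain ⟨c, hc, hAc, hPc⟩ := hG.exists_line A P
  obtain ⟨d, hd, hCd, hPd⟩ := hG.exists_line C P
  obtain ⟨e, he, hCe, hQe⟩ := hG.exists_line C Q
  obtain ⟨f, hf, hAf, hQf⟩ := hG.exists_line A Q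
  have ne := hG.btw_ne hQ
  have hAb : A ∉ b := by grind
  have hCb : C ∉ b := by grind
  have hCc : C ∉ c := by grind
  have hAd : A ∉ d := by grind
  have hQa : Q ∉ a := by grind
  have hcα : c ⊆ α := hG.line_subset_plane c hc α hα A P (by grind) hAc hPc (haα hA) hPα
  have hfα : f ⊆ α := hG.line_subset_plane f hf α hα A Q (by grind) hAf hQf (haα hA) (hbα hQb)
  obtain ⟨Y, hYc, hY⟩ : ∃ Y ∈ c, G.Btw Q Y C := by
    rcases hG.pasch_line hα hb hc hbα A hBb hQb (haα hC) hCb hQ hPc hAc (haα hA) hAb hCc with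
      ⟨Y, hYc, hY⟩ | h
    · have := hG.mem_mid hY ha hB hC
      have : Y = A := by grind
      grind
    · exact h
  obtain ⟨F, hFd, hF⟩ : ∃ Y ∈ d, G.Btw Q Y A := by
    rcases hG.pasch_line hα hb hd hbα C hBb hQb (haα hA) hAb hQ hPd hCd (haα hC) hCb hAd with
      ⟨Y, hYc, hY⟩ | h
    · have := hG.mem_mid hY ha hB hA
      have : Y = C := by grind
      grind
    · exact h
  have hYe := hG.mem_mid hY he hQe hCe
  have hFf := hG.mem_mid hF hf hQf hAf
  have neY := hG.btw_ne hY
  have neF := hG.btw_ne hF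
  have hQc : Q ∉ c := by grind
  have hQd : Q ∉ d := by grind
  have hCf : C ∉ f := by grind
  have hYf : Y ∉ f := by grind
  have hYd : Y ∉ d := by grind
  have hAPY : G.Btw A P Y := by
    rcases hG.pasch_line hα hf hd hfα C hQf hAf (hcα hYc) hYf hF hFd hCd (haα hC) hCf hYd with
      ⟨Z, hZd, hZ⟩ | ⟨Z, hZd, hZ⟩
    · have := hG.mem_mid hZ he hQe hYe
      have : Z = C := by grind
      subst this
      exact absurd hZ (hG.btw_unique _ _ _ (hG.btw_symm _ _ _ hY)).2
    · have := hG.mem_mid hZ hc hAc hYc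
      have : Z = P := by grind
      grind
  rcases hG.pasch_line hα hc hb hcα B hAc hYc (haα hC) hCc hAPY hPb hBb (haα hB) (by grind) hCb with
      ⟨Z, hZd, hZ⟩ | ⟨Z, hZd, hZ⟩
  · have := hG.mem_mid hZ ha hA hC
    have : Z = B := by grind
    grind
  · have := hG.mem_mid hZ he hYe hCe
    have : Z = Q := by grind
    subst this
    exact absurd (hG.btw_symm _ _ _ hZ) (hG.btw_unique _ _ _ hY).2

/-- Of three distinct points on a line, one lies between the two others. -/
theorem btw_trichotomy (hG : G.IsEuclidean) {a : Set E} (ha : a ∈ G.lines) {A B C : E} (hAB : A ≠ B)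
    (hAC : A ≠ C) (hBC : B ≠ C) (hA : A ∈ a) (hB : B ∈ a) (hC : C ∈ a) :
    G.Btw A B C ∨ G.Btw B A C ∨ G.Btw A C B := by
  by_contra! h
  exact h.1 (hG.btw_of_not ha hAB hAC hBC hA hB hC h.2.1 fun h' => h.2.2 (hG.btw_symm _ _ _ h'))

/-- If `B` lies between `A` and `C`, and `C` between `B` and `D`, then `C` lies between `A`, `D`. -/
theorem btw_outer (hG : G.IsEuclidean) {A B C D : E} (h1 : G.Btw A B C) (h2 : G.Btw B C D) :
    G.Btw A C D := by
  obtain ⟨a, ha, hA, hB, hC⟩ := hG.btw_line h1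
  have n1 := hG.btw_ne h1
  have n2 := hG.btw_ne h2
  have hD := hG.mem_right h2 ha hB hC
  obtain ⟨P, hP⟩ := hG.exists_not_mem ha
  obtain ⟨α, hα, haα, hPα⟩ := hG.exists_plane ha hP
  obtain ⟨F, hF⟩ := hG.btw_extend C P (fun h => hP (h ▸ hC))
  obtain ⟨c, hc, hCc, hPc, hFc⟩ := hG.btw_line hF
  obtain ⟨b, hb, hFb, hBb⟩ := hG.exists_line F B
  obtain ⟨d, hd, hAd, hPd⟩ := hG.exists_line A P
  have nF := hG.btw_ne hF
  have un := hG.btw_unique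
  have sy := hG.btw_symm
  have hcα : c ⊆ α := hG.line_subset_plane c hc α hα C P (by grind) hCc hPc (haα hC) hPα
  have hbα : b ⊆ α := hG.line_subset_plane b hb α hα F B (by grind) hFb hBb (hcα hFc) (haα hB)
  have hdα : d ⊆ α := hG.line_subset_plane d hd α hα A P (by grind) hAd hPd (haα hA) hPα
  have hDb : D ∉ b := by grind
  -- Each use of Pasch below has one exit excluded by the order of points already known: `F` is
  -- beyond `P`, `A` beyond `B`, `F` beyond `Q`, and finally `P` beyond `Q`.
  obtain ⟨Q, hQb, hQ⟩ : ∃ Q ∈ b, G.Btw A Q P := by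
    rcases hG.pasch_line hα ha hb haα F hA hC hPα hP h1 hBb hFb (hcα hFc) (by grind) (by grind) with
      h | ⟨Y, hYc, hY⟩
    · exact h
    · have := hG.mem_mid hY hc hCc hPc
      have : Y = F := by grind
      grind
  have hQd := hG.mem_mid hQ hd hAd hPd
  have nQ := hG.btw_ne hQ
  have hFQB : G.Btw F Q B := by
    rcases hG.pasch_line hα hc hd hcα A hCc hFc (haα hB) (by grind) hF hPd hAd (haα hA) (by grind)
      (by grind) with ⟨Y, hYc, hY⟩ | ⟨Y, hYc, hY⟩
    · have := hG.mem_mid hY ha hC hB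
      have : Y = A := by grind
      grind
    · have := hG.mem_mid hY hb hFb hBb
      have : Y = Q := by grind
      grind
  obtain ⟨e, he, hQe, hDe⟩ := hG.exists_line Q D
  obtain ⟨H, hHc, hH⟩ : ∃ H ∈ c, G.Btw D H Q := by
    rcases hG.pasch_line hα ha hc haα F hB hD (hbα hQb) (by grind) h2 hCc hFc (hcα hFc) (by grind)
      (by grind) with ⟨Y, hYc, hY⟩ | h
    · have := hG.mem_mid hY hb hBb hQb
      have : Y = F := by grind
      grind
    · exact h
  have hHe := hG.mem_mid hH he hDe hQe
  have nH := hG.btw_ne hH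
  have heα : e ⊆ α := hG.line_subset_plane e he α hα Q D (by grind) hQe hDe (hbα hQb) (haα hD)
  rcases hG.pasch_line hα he hc heα C hDe hQe (haα hA) (by grind) hH hHc hCc (haα hC) (by grind)
      (by grind) with ⟨Y, hYc, hY⟩ | ⟨Y, hYc, hY⟩
  · have := hG.mem_mid hY ha hD hA
    have : Y = C := by grind
    grind
  · have := hG.mem_mid hY hd hQd hAd
    have : Y = P := by grind
    grind

/-- If `B` lies between `A` and `C`, and `C` between `A` and `D`, then `C` lies between `B`, `D`. -/
theorem btw_inner (hG : G.IsEuclidean) {A B C D : E} (h1 : G.Btw A B C) (h2 : G.Btw A C D) :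
    G.Btw B C D := by
  obtain ⟨a, ha, hA, hB, hC⟩ := hG.btw_line h1
  have n1 := hG.btw_ne h1
  have n2 := hG.btw_ne h2
  have hD := hG.mem_right h2 ha hA hC
  obtain ⟨P, hP⟩ := hG.exists_not_mem ha
  obtain ⟨α, hα, haα, hPα⟩ := hG.exists_plane ha hP
  obtain ⟨F, hF⟩ := hG.btw_extend B P (fun h => hP (h ▸ hB))
  obtain ⟨b, hb, hBb, hPb, hFb⟩ := hG.btw_line hF
  obtain ⟨c, hc, hFc, hCc⟩ := hG.exists_line F C
  obtain ⟨d, hd, hDd, hPd⟩ := hG.exists_line D P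
  obtain ⟨e, he, hAe, hPe⟩ := hG.exists_line A P
  have nF := hG.btw_ne hF
  have un := hG.btw_unique
  have sy := hG.btw_symm
  have hbα : b ⊆ α := hG.line_subset_plane b hb α hα B P (by grind) hBb hPb (haα hB) hPα
  have hdα : d ⊆ α := hG.line_subset_plane d hd α hα D P (by grind) hDd hPd (haα hD) hPα
  have hFa : F ∉ a := by grind
  -- If the line `FC` met the side `AP`, it would have to leave the triangle `APB` at `C` or at `F`,
  -- and both lie beyond the ends of the sides. Hence it leaves `ADP` through `DP`.
  have hAPno : ¬ ∃ Y ∈ c, G.Btw A Y P := by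
    rintro ⟨Y, hYc, hY⟩
    have nY := hG.btw_ne hY
    have hYe := hG.mem_mid hY he hAe hPe
    have hYα := hG.mem_plane_mid hY hα (haα hA) hPα
    have heα : e ⊆ α := hG.line_subset_plane e he α hα A P (by grind) hAe hPe (haα hA) hPα
    rcases hG.pasch_line hα he hc heα F hAe hPe (haα hB) (by grind) hY hYc hFc (hbα hFb) (by grind)
      (by grind) with ⟨Z, hZc, hZ⟩ | ⟨Z, hZc, hZ⟩
    · have := hG.mem_mid hZ ha hA hB
      have : Z = C := by grind
      grind
    · have := hG.mem_mid hZ hb hPb hBb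
      have : Z = F := by grind
      grind
  obtain ⟨H, hHc, hH⟩ : ∃ H ∈ c, G.Btw D H P := by
    rcases hG.pasch_line hα ha hc haα F hA hD hPα (by grind) h2 hCc hFc (hbα hFb) (by grind)
      (by grind) with h | h
    · exact absurd h hAPno
    · exact h
  have hHd := hG.mem_mid hH hd hDd hPd
  have nH := hG.btw_ne hH
  rcases hG.pasch_line hα hd hc hdα C hDd hPd (haα hB) (by grind) hH hHc hCc (haα hC) (by grind)
      (by grind) with ⟨Z, hZc, hZ⟩ | ⟨Z, hZc, hZ⟩
  · have := hG.mem_mid hZ ha hD hB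
    have : Z = C := by grind
    grind
  · have := hG.mem_mid hZ hb hPb hBb
    have : Z = F := by grind
    grind

theorem btw_outer' (hG : G.IsEuclidean) {A B C D : E} (h1 : G.Btw A B C) (h2 : G.Btw B C D) :
    G.Btw A B D :=
  hG.btw_symm _ _ _ (hG.btw_outer (hG.btw_symm _ _ _ h2) (hG.btw_symm _ _ _ h1))

theorem btw_inner' (hG : G.IsEuclidean) {A B C D : E} (h1 : G.Btw A B C) (h2 : G.Btw A C D) :
    G.Btw A B D := hG.btw_outer' h1 (hG.btw_inner h1 h2)

end IsEuclidean
end SyntheticGeometry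

/-! ### Hölder embedding into the real numbers -/

section RealEmbedding

variable {M : Type*} [AddCommMonoid M] [LinearOrder M] [IsOrderedCancelAddMonoid M]

open Algebra in
/-- An Archimedean linearly ordered cancellative monoid with subtraction embeds into `ℝ`. -/
theorem exists_strictMono_addMonoidHom_real (hsub : ∀ x y : M, x ≤ y → ∃ z, y = x + z)
    (harch : ∀ x y : M, 0 < y → ∃ n : ℕ, x ≤ n • y) : ∃ f : M →+ ℝ, StrictMono f := by
  let e : M → GrothendieckAddGroup M := fun x => AddLocalization.mk x 0
  have he0 : e 0 = 0 := AddLocalization.mk_zero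
  have hadd : ∀ x y, e (x + y) = e x + e y := fun x y => by
    simp only [e, AddLocalization.mk_add, add_zero]
  have hmono : StrictMono e :=
    (AddLocalization.mkOrderEmbedding (0 : (⊤ : AddSubmonoid M))).strictMono
  have hnsmul : ∀ (n : ℕ) x, e (n • x) = n • e x := fun n x => by
    induction n with
    | zero => rw [zero_smul, zero_smul, he0]
    | succ n ih => rw [succ_nsmul, succ_nsmul, hadd, ih]
  -- By subtraction a nonnegative formal difference already comes from `M`, so the Archimedean
  -- property passes to the whole group.
  have hmk : ∀ a : GrothendieckAddGroup M, 0 ≤ a → ∃ x : M, a = e x := by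
    intro a
    induction a using AddLocalization.ind with | _ p => ?_
    obtain ⟨a, s⟩ := p
    intro h
    rw [← he0, AddLocalization.mk_le_mk] at h
    obtain ⟨z, hz⟩ := hsub s a (by simpa using h)
    exact ⟨z, by rw [AddLocalization.mk_eq_mk_iff, AddLocalization.r_iff_exists]
                 exact ⟨0, by simp [hz]⟩⟩
  have : Archimedean (GrothendieckAddGroup M) := ⟨fun a b hb => by
    obtain ⟨y, rfl⟩ := hmk b hb.le
    rcases le_total 0 a with h | h
    · obtain ⟨x, rfl⟩ := hmk a h
      obtain ⟨n, hn⟩ := harch x y (hmono.lt_iff_lt.1 (he0.symm ▸ hb))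
      exact ⟨n, hnsmul n y ▸ hmono.monotone hn⟩
    · exact ⟨0, by rwa [zero_smul]⟩⟩
  obtain ⟨f, hf⟩ := Archimedean.exists_orderAddMonoidHom_real_injective (GrothendieckAddGroup M)
  refine ⟨⟨⟨fun x => f (e x), by rw [he0, map_zero]⟩, fun x y => by
    change f (e (x + y)) = f (e x) + f (e y)
    rw [hadd, map_add]⟩, ?_⟩
  exact (f.monotone'.strictMono_of_injective hf).comp hmono

end RealEmbedding

/-! ### The monoid of segment classes and the existence of a length function -/

namespace SyntheticGeometry
variable {E : Type*} {G : SyntheticGeometry E}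

variable (G) in
/-- Betweenness with coinciding points allowed. -/
def WBtw (A B C : E) : Prop := A = B ∨ B = C ∨ G.Btw A B C

variable (G) in
/-- Congruence of segments, degenerate ones included. -/
def PairCong (A B C D : E) : Prop :=
  (A = B ∧ C = D) ∨ (A ≠ B ∧ C ≠ D ∧ G.SegCong (G.seg A B) (G.seg C D))

namespace IsEuclidean

theorem seg_comm (hG : G.IsEuclidean) (A B : E) : G.seg A B = G.seg B A := by
  ext X
  have := hG.btw_symm A X B
  have := hG.btw_symm B X A
  simp only [seg, Set.mem_ofPred_eq]
  tauto

/-- Symmetry is not an axiom. Laying `CD` off on the ray `AB` gives a point `Q` with `AB ≅ AQ` by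
transitivity, and uniqueness of laying off forces `Q = B`. -/
theorem segCong_symm (hG : G.IsEuclidean) {A B C D : E} (h1 : A ≠ B) (h2 : C ≠ D)
    (h : G.SegCong (G.seg A B) (G.seg C D)) : G.SegCong (G.seg C D) (G.seg A B) := by
  obtain ⟨Q, ⟨hQ1, hQ2, hQ⟩, -⟩ := hG.seg_transfer C D A B h2 h1
  have h3 := hG.segCong_trans A B C D A Q h1 h2 hQ2.symm h hQ
  have := (hG.seg_transfer A B A B h1 h1).unique ⟨hQ1, hQ2, h3⟩
    ⟨Or.inr (Or.inl rfl), h1.symm, hG.segCong_refl A B h1⟩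
  rwa [this] at hQ

theorem pairCong_refl (hG : G.IsEuclidean) (A B : E) : G.PairCong A B A B := by
  by_cases h : A = B
  · exact Or.inl ⟨h, h⟩
  · exact Or.inr ⟨h, h, hG.segCong_refl A B h⟩

theorem pairCong_symm (hG : G.IsEuclidean) {A B C D : E} (h : G.PairCong A B C D) :
    G.PairCong C D A B := by
  rcases h with h | ⟨h1, h2, h⟩
  · exact Or.inl h.symm
  · exact Or.inr ⟨h2, h1, hG.segCong_symm h1 h2 h⟩

theorem pairCong_trans (hG : G.IsEuclidean) {A B C D K L : E} (h : G.PairCong A B C D)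
    (h' : G.PairCong C D K L) : G.PairCong A B K L := by
  rcases h with h | ⟨h1, h2, h⟩ <;> rcases h' with h' | ⟨h1', h2', h'⟩
  · exact Or.inl ⟨h.1, h'.2⟩
  · exact absurd h.2 h1'
  · exact absurd h'.1 h2
  · exact Or.inr ⟨h1, h2', hG.segCong_trans A B C D K L h1 h2 h2' h h'⟩

theorem pairCong_swap (hG : G.IsEuclidean) (A B : E) : G.PairCong A B B A := by
  by_cases h : A = B
  · exact Or.inl ⟨h, h.symm⟩
  · exact Or.inr ⟨h, Ne.symm h, hG.seg_comm A B ▸ hG.segCong_refl A B h⟩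

/-- Congruence of (possibly degenerate) segments as an equivalence relation. -/
def segSetoid (hG : G.IsEuclidean) : Setoid (E × E) where
  r p q := G.PairCong p.1 p.2 q.1 q.2
  iseqv := ⟨fun p => hG.pairCong_refl p.1 p.2, hG.pairCong_symm, hG.pairCong_trans⟩

theorem wbtw_symm (hG : G.IsEuclidean) {A B C : E} (h : G.WBtw A B C) : G.WBtw C B A := by
  rcases h with h | h | h
  · exact Or.inr (Or.inl h.symm)
  · exact Or.inl h.symm
  · exact Or.inr (Or.inr (hG.btw_symm _ _ _ h))

theorem eq_of_wbtw (hG : G.IsEuclidean) {A B : E} (h : G.WBtw A B A) : A = B := by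
  rcases h with h | h | h
  · exact h
  · exact h.symm
  · exact absurd rfl (hG.btw_ne h).2.1

theorem wbtw_inner (hG : G.IsEuclidean) {A B C D : E} (h1 : G.WBtw A B C) (h2 : G.WBtw A C D) :
    G.WBtw B C D ∧ G.WBtw A B D := by
  rcases h1 with rfl | rfl | h1
  · exact ⟨h2, Or.inl rfl⟩
  · exact ⟨Or.inl rfl, h2⟩
  · rcases h2 with rfl | rfl | h2
    · exact absurd rfl (hG.btw_ne h1).2.1
    · exact ⟨Or.inr (Or.inl rfl), Or.inr (Or.inr h1)⟩
    · exact ⟨Or.inr (Or.inr (hG.btw_inner h1 h2)), Or.inr (Or.inr (hG.btw_inner' h1 h2))⟩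

theorem pairCong_add (hG : G.IsEuclidean) {A B C K L M : E} (h1 : G.WBtw A B C)
    (h2 : G.WBtw K L M) (h3 : G.PairCong A B K L) (h4 : G.PairCong B C L M) :
    G.PairCong A C K M := by
  rcases h3 with ⟨rfl, rfl⟩ | ⟨n1, n2, h3⟩
  · exact h4
  rcases h4 with ⟨rfl, rfl⟩ | ⟨n3, n4, h4⟩
  · exact Or.inr ⟨n1, n2, h3⟩
  rcases h1 with h1 | h1 | h1
  · exact absurd h1 n1
  · exact absurd h1 n3
  rcases h2 with h2 | h2 | h2
  · exact absurd h2 n2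
  · exact absurd h2 n4
  exact Or.inr ⟨(hG.btw_ne h1).2.1, (hG.btw_ne h2).2.1, hG.seg_add _ _ _ _ _ _ h1 h2 h3 h4⟩

theorem exists_pairCong (hG : G.IsEuclidean) (A B : E) {C Q : E} (h : C ≠ Q) :
    ∃ D ∈ G.ray C Q, G.PairCong A B C D := by
  by_cases hAB : A = B
  · exact ⟨C, Or.inl rfl, Or.inl ⟨hAB, rfl⟩⟩
  · obtain ⟨D, ⟨h1, h2, h3⟩, -⟩ := hG.seg_transfer A B C Q hAB h
    exact ⟨D, h1, Or.inr ⟨hAB, h2.symm, h3⟩⟩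

theorem eq_of_pairCong (hG : G.IsEuclidean) {C Q D D' : E} (h : C ≠ Q) (hD : D ∈ G.ray C Q)
    (hD' : D' ∈ G.ray C Q) (hc : G.PairCong C D C D') : D = D' := by
  rcases hc with ⟨h1, h2⟩ | ⟨h1, h2, h3⟩
  · exact h1.symm.trans h2
  · exact (hG.seg_transfer C D C Q h1 h).unique ⟨hD, h1.symm, hG.segCong_refl C D h1⟩
      ⟨hD', h2.symm, h3⟩

theorem mem_ray_of_wbtw {A B C : E} (h : G.WBtw A B C) (hAB : A ≠ B) : C ∈ G.ray A B := by
  rcases h with h | rfl | h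
  · exact absurd h hAB
  · exact Or.inr (Or.inl rfl)
  · exact Or.inr (Or.inr (Or.inr h))

theorem exists_wbtw (hG : G.IsEuclidean) (A B K L : E) :
    ∃ C, G.WBtw A B C ∧ G.PairCong K L B C := by
  by_cases hAB : A = B
  · obtain ⟨Q, hQ⟩ := hG.exists_ne B
    obtain ⟨C, -, hC⟩ := hG.exists_pairCong K L hQ
    exact ⟨C, Or.inl hAB, hC⟩
  · obtain ⟨Q, hQ⟩ := hG.btw_extend A B hAB
    obtain ⟨C, hC, hC'⟩ := hG.exists_pairCong K L (hG.btw_ne hQ).2.2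
    refine ⟨C, ?_, hC'⟩
    rcases hC with rfl | rfl | h | h
    · exact Or.inr (Or.inl rfl)
    · exact Or.inr (Or.inr hQ)
    · exact Or.inr (Or.inr (hG.btw_symm _ _ _ (hG.btw_inner (hG.btw_symm _ _ _ h)
        (hG.btw_symm _ _ _ hQ))))
    · exact Or.inr (Or.inr (hG.btw_outer' hQ h))

/-- The congruence classes of segments. -/
def SegClass (hG : G.IsEuclidean) : Type _ := Quotient hG.segSetoid

namespace SegClass

variable {hG : G.IsEuclidean}

variable (hG) in
/-- The congruence class of a segment. -/
def mk (A B : E) : SegClass hG := Quotient.mk hG.segSetoid (A, B)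

theorem mk_eq {A B C D : E} : mk hG A B = mk hG C D ↔ G.PairCong A B C D :=
  ⟨fun h => Quotient.exact h, fun h => Quotient.sound h⟩

theorem exists_rep (x : SegClass hG) : ∃ A B, x = mk hG A B := by
  induction x using Quotient.ind with | _ p => exact ⟨p.1, p.2, rfl⟩

theorem mk_comm (A B : E) : mk hG A B = mk hG B A := mk_eq.2 (hG.pairCong_swap A B)

theorem mk_self (A B : E) : mk hG A A = mk hG B B := mk_eq.2 (Or.inl ⟨rfl, rfl⟩)

theorem eq_of_mk_eq {A B C : E} (h : mk hG A B = mk hG C C) : A = B := by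
  rcases mk_eq.1 h with h | h
  · exact h.1
  · exact absurd rfl h.2.1

theorem exists_extend (A B : E) (x : SegClass hG) : ∃ C, G.WBtw A B C ∧ mk hG B C = x := by
  obtain ⟨K, L, rfl⟩ := exists_rep x
  obtain ⟨C, h, h'⟩ := hG.exists_wbtw A B K L
  exact ⟨C, h, mk_eq.2 (hG.pairCong_symm h')⟩

/-- Well-definedness of addition: placing segments end to end gives a class independent of
representatives, because sums of congruent segments are congruent. -/
theorem exists_sum (x y : SegClass hG) :
    ∃ z, ∀ A B C, G.WBtw A B C → mk hG A B = x → mk hG B C = y → mk hG A C = z := by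
  obtain ⟨A, B, rfl⟩ := exists_rep x
  obtain ⟨C, hC, rfl⟩ := exists_extend A B y
  exact ⟨mk hG A C, fun A' B' C' h h1 h2 => mk_eq.2 (hG.pairCong_add h hC (mk_eq.1 h1)
    (mk_eq.1 h2))⟩

noncomputable instance : Add (SegClass hG) := ⟨fun x y => (exists_sum x y).choose⟩

theorem mk_add_mk {A B C : E} (h : G.WBtw A B C) : mk hG A B + mk hG B C = mk hG A C :=
  ((exists_sum (mk hG A B) (mk hG B C)).choose_spec A B C h rfl rfl).symm

theorem nonempty (hG : G.IsEuclidean) : Nonempty E :=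
  let ⟨A, _⟩ := hG.exists_not_collin; ⟨A⟩

noncomputable instance : Zero (SegClass hG) := ⟨mk hG (nonempty hG).some (nonempty hG).some⟩

theorem mk_eq_zero {A B : E} : mk hG A B = 0 ↔ A = B :=
  ⟨fun h => eq_of_mk_eq h, fun h => h ▸ mk_self A _⟩

protected theorem add_comm (x y : SegClass hG) : x + y = y + x := by
  obtain ⟨A, B, rfl⟩ := exists_rep x
  obtain ⟨C, hC, rfl⟩ := exists_extend A B y
  rw [mk_add_mk hC, mk_comm A B, mk_comm B C, mk_add_mk (hG.wbtw_symm hC), mk_comm]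

protected theorem add_assoc (x y z : SegClass hG) : x + y + z = x + (y + z) := by
  obtain ⟨A, B, rfl⟩ := exists_rep x
  obtain ⟨C, hC, rfl⟩ := exists_extend A B y
  obtain ⟨D, hD, rfl⟩ := exists_extend A C z
  have := hG.wbtw_inner hC hD
  rw [mk_add_mk hC, mk_add_mk hD, mk_add_mk this.1, mk_add_mk this.2]

protected theorem zero_add (x : SegClass hG) : 0 + x = x := by
  obtain ⟨A, B, rfl⟩ := exists_rep x
  rw [← mk_eq_zero.2 (rfl : A = A), mk_add_mk (Or.inl rfl)]

noncomputable instance : AddCommMonoid (SegClass hG) where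
  add_assoc := SegClass.add_assoc
  zero_add := SegClass.zero_add
  add_zero x := by rw [SegClass.add_comm, SegClass.zero_add]
  add_comm := SegClass.add_comm
  nsmul := nsmulRec

/-- Both sums are realized on the same ray from `A` through `B`, where a given segment can be laid
off in only one way. -/
theorem add_cancel {x y z : SegClass hG} (h : x + y = x + z) : y = z := by
  obtain ⟨A, B, rfl⟩ := exists_rep x
  obtain ⟨C, hC, rfl⟩ := exists_extend A B y
  obtain ⟨D, hD, rfl⟩ := exists_extend A B z
  by_cases hAB : A = B
  · rwa [mk_eq_zero.2 hAB, zero_add, zero_add] at h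
  · rw [mk_add_mk hC, mk_add_mk hD] at h
    rw [hG.eq_of_pairCong hAB (mem_ray_of_wbtw hC hAB) (mem_ray_of_wbtw hD hAB) (mk_eq.1 h)]

theorem eq_zero_of_add {x y : SegClass hG} (h : x + y = 0) : x = 0 := by
  obtain ⟨A, B, rfl⟩ := exists_rep x
  obtain ⟨C, hC, rfl⟩ := exists_extend A B y
  rw [mk_add_mk hC, mk_eq_zero] at h
  subst h
  exact mk_eq_zero.2 (hG.eq_of_wbtw hC)

theorem exists_mk_ray (x : SegClass hG) {A B : E} (hAB : A ≠ B) :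
    ∃ C ∈ G.ray A B, mk hG A C = x := by
  obtain ⟨K, L, rfl⟩ := exists_rep x
  obtain ⟨C, hC, h⟩ := hG.exists_pairCong K L hAB
  exact ⟨C, hC, mk_eq.2 (hG.pairCong_symm h)⟩

protected theorem le_total (x y : SegClass hG) : (∃ z, y = x + z) ∨ ∃ z, x = y + z := by
  obtain ⟨A, B, rfl⟩ := exists_rep x
  by_cases hAB : A = B
  · exact Or.inl ⟨y, by rw [mk_eq_zero.2 hAB, zero_add]⟩
  · obtain ⟨C, hC, rfl⟩ := exists_mk_ray y hAB
    have : G.WBtw A B C ∨ G.WBtw A C B := by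
      rcases hC with rfl | rfl | h | h
      · exact Or.inr (Or.inl rfl)
      · exact Or.inl (Or.inr (Or.inl rfl))
      · exact Or.inr (Or.inr (Or.inr h))
      · exact Or.inl (Or.inr (Or.inr h))
    rcases this with h | h
    · exact Or.inl ⟨_, (mk_add_mk h).symm⟩
    · exact Or.inr ⟨_, (mk_add_mk h).symm⟩

-- With this order, subtraction holds by definition. Antisymmetry comes from cancellation and from
-- the fact that a sum vanishes only if its terms do.
open Classical in
noncomputable instance : LinearOrder (SegClass hG) where
  le x y := ∃ z, y = x + z
  le_refl x := ⟨0, (add_zero x).symm⟩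
  le_trans := by
    rintro x _ _ ⟨z, rfl⟩ ⟨w, rfl⟩
    exact ⟨z + w, add_assoc _ _ _⟩
  le_antisymm := by
    rintro x _ ⟨z, rfl⟩ ⟨w, h⟩
    rw [add_assoc] at h
    rw [eq_zero_of_add (add_cancel ((add_zero x).trans h)).symm, add_zero]
  le_total := SegClass.le_total
  toDecidableLE := fun _ _ => Classical.propDecidable _

instance : IsOrderedCancelAddMonoid (SegClass hG) where
  add_le_add_left := by
    rintro x _ ⟨z, rfl⟩ w
    exact ⟨z, add_right_comm _ _ _⟩
  le_of_add_le_add_left := by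
    rintro x y z ⟨w, h⟩
    rw [add_assoc] at h
    exact ⟨w, add_cancel h⟩

theorem exists_le_nsmul (x y : SegClass hG) (hy : 0 < y) : ∃ n : ℕ, x ≤ n • y := by
  obtain ⟨I, J, rfl⟩ := exists_rep y
  obtain ⟨A, B, rfl⟩ := exists_rep x
  by_cases hAB : A = B
  · exact ⟨0, by rw [mk_eq_zero.2 hAB, zero_smul]⟩
  have hIJ : I ≠ J := fun h => hy.ne' (mk_eq_zero.2 h)
  obtain ⟨n, -, C, D, ⟨P, rfl, rfl, h1, h2⟩, F, hF, hF'⟩ := hG.archimedes A B I J hAB hIJ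
  refine ⟨n, ?_⟩
  -- A replica sum records betweenness of consecutive triples only. The induction propagates it to
  -- triples starting at `P 0`, so that the classes add up; `WBtw` covers the degenerate start `m =
  -- 0`.
  have key : ∀ m, (m + 1 ≤ n → G.WBtw (P 0) (P m) (P (m + 1))) ∧
      (m ≤ n → mk hG (P 0) (P m) = m • mk hG I J) := by
    intro m
    induction m with
    | zero => exact ⟨fun _ => Or.inl rfl, fun _ => by rw [zero_smul, mk_eq_zero]⟩
    | succ m ih =>
      refine ⟨fun h => ?_, fun h => ?_⟩
      · rcases ih.1 (by omega) with h' | h' | h'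
        · rw [h']; exact Or.inr (Or.inr (h2 m h))
        · exact absurd h' (h1 m (by omega)).1
        · exact Or.inr (Or.inr (hG.btw_outer h' (h2 m h)))
      · have h3 := h1 m (by omega)
        rw [succ_nsmul, ← ih.2 (by omega), ← mk_add_mk (ih.1 h),
          mk_eq.2 (Or.inr ⟨h3.1, hIJ, h3.2⟩)]
  rw [← (key n).2 le_rfl, ← mk_add_mk (Or.inr (Or.inr hF)),
    mk_eq.2 (Or.inr ⟨hAB, (hG.btw_ne hF).1, hF'⟩)]
  exact ⟨_, rfl⟩

end SegClass

theorem exists_isLengthFunction (hG : G.IsEuclidean) {I J : E} (hIJ : I ≠ J) :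
    ∃ l, G.IsLengthFunction I J l := by
  obtain ⟨f, hf⟩ := exists_strictMono_addMonoidHom_real (M := SegClass hG) (fun _ _ h => h)
    SegClass.exists_le_nsmul
  have pos : ∀ A B, A ≠ B → 0 < f (SegClass.mk hG A B) := fun A B h => by
    rw [← map_zero f]
    refine hf (lt_of_le_of_ne ⟨_, (zero_add _).symm⟩ fun h' => h (SegClass.mk_eq_zero.1 h'.symm))
  refine ⟨fun A B => f (SegClass.mk hG A B) / f (SegClass.mk hG I J), ?_, ?_, ?_, ?_, ?_⟩
  · intro A
    simp [SegClass.mk_eq_zero.2]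
  · exact fun A B h => div_pos (pos A B h) (pos I J hIJ)
  · exact div_self (pos I J hIJ).ne'
  · intro A B C D h1 h2 h
    rw [SegClass.mk_eq.2 (Or.inr ⟨h1, h2, h⟩)]
  · intro A B C h
    rw [← SegClass.mk_add_mk (Or.inr (Or.inr h)), map_add, add_div]

end IsEuclidean
end SyntheticGeometry

/-! ### Rays, completeness of the set of lengths, and rulers -/

namespace SyntheticGeometry
variable {E : Type*} {G : SyntheticGeometry E}

namespace IsEuclidean

theorem btw_of_not_btw (hG : G.IsEuclidean) {a : Set E} (ha : a ∈ G.lines) {O A B X : E}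
    (hO : O ∈ a) (hA : A ∈ a) (hB : B ∈ a) (hBO : B ≠ O) (h : ¬ G.Btw B O A) (hX : G.Btw X O A) :
    G.Btw X O B := by
  by_cases hAB : A = B
  · exact hAB ▸ hX
  have := hG.btw_ne hX
  rcases hG.btw_trichotomy ha this.2.2 hBO.symm hAB hO hA hB with h' | h' | h'
  · exact hG.btw_outer' hX h'
  · exact absurd (hG.btw_symm _ _ _ h') h
  · exact hG.btw_symm _ _ _ (hG.btw_inner (hG.btw_symm _ _ _ h') (hG.btw_symm _ _ _ hX))

theorem not_btw_of_btw_of_btw (hG : G.IsEuclidean) {O A B C : E} (h1 : G.Btw A O B)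
    (h2 : G.Btw B O C) : ¬ G.Btw A O C := by
  intro h3
  obtain ⟨a, ha, hA, hO, hB⟩ := hG.btw_line h1
  have hC := hG.mem_right h2 ha hB hO
  rcases hG.btw_trichotomy ha (hG.btw_ne h1).2.1 (hG.btw_ne h3).2.1 (hG.btw_ne h2).2.1 hA hB hC
    with h | h | h
  · exact (hG.btw_unique _ _ _ (hG.btw_inner h1 h)).2 (hG.btw_symm _ _ _ h2)
  · exact (hG.btw_unique _ _ _ (hG.btw_inner (hG.btw_symm _ _ _ h1) h)).2 (hG.btw_symm _ _ _ h3)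
  · exact (hG.btw_unique _ _ _ (hG.btw_inner h3 h)).2 h2

theorem mem_ray_iff (hG : G.IsEuclidean) {O A X : E} (h : O ≠ A) :
    X ∈ G.ray O A ↔ X ∈ G.line O A ∧ ¬ G.Btw X O A := by
  have h1 := hG.left_mem_line O A
  have h2 := hG.right_mem_line O A
  have h3 := hG.line_mem h
  constructor
  · rintro (rfl | rfl | h' | h')
    · exact ⟨h1, fun h => (hG.btw_ne h).1 rfl⟩
    · exact ⟨h2, fun h => (hG.btw_ne h).2.1 rfl⟩
    · exact ⟨hG.mem_mid h' h3 h1 h2, fun h => (hG.btw_unique _ _ _ h').2 (hG.btw_symm _ _ _ h)⟩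
    · exact ⟨hG.mem_right h' h3 h1 h2, fun h => (hG.btw_unique _ _ _ h').2 h⟩
  · rintro ⟨hX, h'⟩
    by_cases hXO : X = O
    · exact Or.inl hXO
    by_cases hXA : X = A
    · exact Or.inr (Or.inl hXA)
    · rcases hG.btw_trichotomy h3 h (Ne.symm hXO) (Ne.symm hXA) h1 h2 hX with h4 | h4 | h4
      · exact Or.inr (Or.inr (Or.inr h4))
      · exact absurd (hG.btw_symm _ _ _ h4) h'
      · exact Or.inr (Or.inr (Or.inl h4))

theorem wbtw_or_of_mem_ray (hG : G.IsEuclidean) {O A X Y : E} (h : O ≠ A) (hX : X ∈ G.ray O A)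
    (hY : Y ∈ G.ray O A) : G.WBtw O X Y ∨ G.WBtw O Y X := by
  rw [hG.mem_ray_iff h] at hX hY
  by_cases h1 : X = O
  · exact Or.inl (Or.inl h1.symm)
  by_cases h2 : Y = O
  · exact Or.inr (Or.inl h2.symm)
  by_cases h3 : X = Y
  · exact Or.inl (Or.inr (Or.inl h3))
  have h4 := hG.left_mem_line O A
  rcases hG.btw_trichotomy (hG.line_mem h) (Ne.symm h1) (Ne.symm h2) h3 h4 hX.1 hY.1
    with h5 | h5 | h5
  · exact Or.inl (Or.inr (Or.inr h5))
  · exfalso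
    exact hY.2 (hG.btw_of_not_btw (hG.line_mem h) h4 hX.1 (hG.right_mem_line O A) h.symm
      (fun h' => hX.2 (hG.btw_symm _ _ _ h')) (hG.btw_symm _ _ _ h5))
  · exact Or.inr (Or.inr (Or.inr h5))

end IsEuclidean

namespace IsLengthFunction

variable {I J : E} {l : E → E → ℝ}

theorem comm (hl : G.IsLengthFunction I J l) (hG : G.IsEuclidean) (A B : E) : l A B = l B A := by
  by_cases h : A = B
  · rw [h]
  · exact hl.congr _ _ _ _ h (Ne.symm h) (hG.seg_comm A B ▸ hG.segCong_refl A B h)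

theorem nonneg (hl : G.IsLengthFunction I J l) (A B : E) : 0 ≤ l A B := by
  by_cases h : A = B
  · rw [h, hl.degenerate]
  · exact (hl.pos A B h).le

theorem eq_of_zero (hl : G.IsLengthFunction I J l) {A B : E} (h : l A B = 0) : A = B := by
  by_contra hAB
  exact (hl.pos A B hAB).ne' h

theorem eq_of_pairCong (hl : G.IsLengthFunction I J l) {A B C D : E} (h : G.PairCong A B C D) :
    l A B = l C D := by
  rcases h with ⟨rfl, rfl⟩ | ⟨h1, h2, h⟩
  · rw [hl.degenerate, hl.degenerate]
  · exact hl.congr _ _ _ _ h1 h2 h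

theorem wbtw_add (hl : G.IsLengthFunction I J l) {A B C : E} (h : G.WBtw A B C) :
    l A C = l A B + l B C := by
  rcases h with rfl | rfl | h
  · rw [hl.degenerate, zero_add]
  · rw [hl.degenerate, add_zero]
  · exact hl.add _ _ _ h

theorem eq_of_mem_ray (hl : G.IsLengthFunction I J l) (hG : G.IsEuclidean) {O A X Y : E}
    (h : O ≠ A) (hX : X ∈ G.ray O A) (hY : Y ∈ G.ray O A) (heq : l O X = l O Y) : X = Y := by
  rcases hG.wbtw_or_of_mem_ray h hX hY with h' | h' <;> have := hl.wbtw_add h'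
  · exact hl.eq_of_zero (by linarith)
  · exact (hl.eq_of_zero (by linarith)).symm

theorem btw_of_lt (hl : G.IsLengthFunction I J l) (hG : G.IsEuclidean) {O A X Y : E}
    (h : O ≠ A) (hX : X ∈ G.ray O A) (hY : Y ∈ G.ray O A) (h0 : 0 < l O X) (hlt : l O X < l O Y) :
    G.Btw O X Y := by
  rcases hG.wbtw_or_of_mem_ray h hX hY with (rfl | rfl | h') | h'
  · rw [hl.degenerate] at h0; exact absurd h0 (lt_irrefl _)
  · exact absurd hlt (lt_irrefl _)
  · exact h'
  · have := hl.wbtw_add h'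
    have := hl.nonneg Y X
    linarith

/-- Lay `AB` off on the ray `CD`. The end point has the same distance from `C` as `D` has, and
points of a ray are determined by that distance. Congruence thus becomes equality of numbers. -/
theorem segCong_of_eq (hl : G.IsLengthFunction I J l) (hG : G.IsEuclidean) {A B C D : E}
    (h1 : A ≠ B) (h2 : C ≠ D) (h : l A B = l C D) : G.SegCong (G.seg A B) (G.seg C D) := by
  obtain ⟨X, ⟨hX, hXC, hc⟩, -⟩ := hG.seg_transfer A B C D h1 h2
  have := hl.congr _ _ _ _ h1 hXC.symm hc
  rwa [hl.eq_of_mem_ray hG h2 hX (Or.inr (Or.inl rfl)) (this.symm.trans h)] at hc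

theorem exists_add (hl : G.IsLengthFunction I J l) (hG : G.IsEuclidean) (A B C D : E) :
    ∃ K L, l K L = l A B + l C D := by
  obtain ⟨X, h, h'⟩ := hG.exists_wbtw A B C D
  exact ⟨A, X, by rw [hl.wbtw_add h, hl.eq_of_pairCong h']⟩

theorem exists_sub (hl : G.IsLengthFunction I J l) (hG : G.IsEuclidean) {A B C D : E}
    (hle : l C D ≤ l A B) : ∃ K L, l K L = l A B - l C D := by
  by_cases hAB : A = B
  · have := hl.nonneg C D
    rw [hAB, hl.degenerate] at hle ⊢
    exact ⟨A, A, by rw [hl.degenerate]; linarith⟩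
  obtain ⟨X, h, h'⟩ := hG.exists_pairCong C D hAB
  have := hl.eq_of_pairCong h'
  rcases hG.wbtw_or_of_mem_ray hAB h (Or.inr (Or.inl rfl)) with h' | h' <;>
    have h3 := hl.wbtw_add h'
  · exact ⟨X, B, by linarith⟩
  · have := hl.nonneg B X
    exact ⟨A, A, by rw [hl.degenerate]; linarith⟩

/-- The subgroup of `ℝ` generated by the values of a length function. -/
def valueGroup (hl : G.IsLengthFunction I J l) (hG : G.IsEuclidean) : AddSubgroup ℝ where
  carrier := {r | ∃ A B C D, r = l A B - l C D}
  zero_mem' := ⟨I, J, I, J, by ring⟩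
  neg_mem' := by
    rintro _ ⟨A, B, C, D, rfl⟩
    exact ⟨C, D, A, B, by ring⟩
  add_mem' := by
    rintro _ _ ⟨A, B, C, D, rfl⟩ ⟨A', B', C', D', rfl⟩
    obtain ⟨K, L, h⟩ := hl.exists_add hG A B A' B'
    obtain ⟨K', L', h'⟩ := hl.exists_add hG C D C' D'
    exact ⟨K, L, K', L', by rw [h, h']; ring⟩

theorem exists_of_mem_valueGroup (hl : G.IsLengthFunction I J l) (hG : G.IsEuclidean) {r : ℝ}
    (hr : 0 ≤ r) (h : r ∈ hl.valueGroup hG) : ∃ A B, l A B = r := by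
  obtain ⟨A, B, C, D, rfl⟩ := h
  exact hl.exists_sub hG (by linarith)

theorem mem_valueGroup (hl : G.IsLengthFunction I J l) (hG : G.IsEuclidean) (A B : E) :
    l A B ∈ hl.valueGroup hG := ⟨A, B, A, A, by rw [hl.degenerate, sub_zero]⟩

/-- A least positive value would be the length of a segment, but an interior point cuts off a
shorter one. -/
theorem dense_valueGroup (hl : G.IsLengthFunction I J l) (hG : G.IsEuclidean) :
    Dense (hl.valueGroup hG : Set ℝ) := by
  refine AddSubgroup.dense_of_no_min _ (fun h => ?_) ?_
  · have := hl.mem_valueGroup hG I J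
    rw [h, hl.unit, AddSubgroup.mem_bot] at this
    exact one_ne_zero this
  · rintro ⟨r, ⟨hr, hr0⟩, hmin⟩
    obtain ⟨A, B, rfl⟩ := hl.exists_of_mem_valueGroup hG hr0.le hr
    have hAB : A ≠ B := by rintro rfl; rw [hl.degenerate] at hr0; exact lt_irrefl _ hr0
    obtain ⟨X, hX⟩ := hG.exists_btw hAB
    have h1 := hl.add _ _ _ hX
    have h2 := hl.pos _ _ (hG.btw_ne hX).2.2
    have := hmin ⟨hl.mem_valueGroup hG A X, hl.pos _ _ (hG.btw_ne hX).1⟩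
    linarith

theorem exists_mem_ray_of_mem (hl : G.IsLengthFunction I J l) (hG : G.IsEuclidean) {r : ℝ}
    (hr : 0 ≤ r) (h : r ∈ hl.valueGroup hG) {O A : E} (hOA : O ≠ A) :
    ∃ X ∈ G.ray O A, l O X = r := by
  obtain ⟨C, D, rfl⟩ := hl.exists_of_mem_valueGroup hG hr h
  obtain ⟨X, h, h'⟩ := hG.exists_pairCong C D hOA
  exact ⟨X, h, (hl.eq_of_pairCong h').symm⟩

/-- Every positive real number is a length. -/
theorem exists_eq (hl : G.IsLengthFunction I J l) (hG : G.IsEuclidean) {r : ℝ} (hr : 0 < r) :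
    ∃ A B, l A B = r := by
  obtain ⟨C, Q, hCQ⟩ : ∃ C Q : E, C ≠ Q := let ⟨A, B, _, h, _⟩ := hG.exists_not_collin; ⟨A, B, h⟩
  -- Lengths increasing to `r` and decreasing to `r`, laid off on one ray, bound nested segments.
  -- Cantor's axiom supplies a common point, whose distance from `C` is squeezed to `r`.
  obtain ⟨u, hu, hur, hut⟩ := (hl.dense_valueGroup hG).exists_seq_strictMono_tendsto_of_lt hr
  obtain ⟨v, hv, hvr, hvt⟩ :=
    (hl.dense_valueGroup hG).exists_seq_strictAnti_tendsto_of_lt (lt_add_one r)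
  choose A hA hAu using fun n => hl.exists_mem_ray_of_mem hG (hur n).1.1.le (hur n).2 hCQ
  choose B hB hBv using fun n =>
    hl.exists_mem_ray_of_mem hG (hr.trans (hvr n).1.1).le (hvr n).2 hCQ
  have pu : ∀ n, 0 < l C (A n) := fun n => hAu n ▸ (hur n).1.1
  have pv : ∀ n, 0 < l C (B n) := fun n => hBv n ▸ hr.trans (hvr n).1.1
  have hAA : ∀ n, G.Btw C (A n) (A (n + 1)) := fun n =>
    hl.btw_of_lt hG hCQ (hA _) (hA _) (pu n) (by rw [hAu, hAu]; exact hu n.lt_succ_self)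
  have hBB : ∀ n, G.Btw C (B (n + 1)) (B n) := fun n =>
    hl.btw_of_lt hG hCQ (hB _) (hB _) (pv _) (by rw [hBv, hBv]; exact hv n.lt_succ_self)
  have hAB : ∀ n m, G.Btw C (A n) (B m) := fun n m =>
    hl.btw_of_lt hG hCQ (hA _) (hB _) (pu _)
      (by rw [hAu, hBv]; exact (hur n).1.2.trans (hvr m).1.1)
  obtain ⟨X, hX⟩ := hG.cantor _ (hG.line_mem hCQ) A B
    (fun n => ⟨(hG.btw_ne (hAB n n)).2.2, ((hG.mem_ray_iff hCQ).1 (hA n)).1,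
      ((hG.mem_ray_iff hCQ).1 (hB n)).1⟩) (by
      intro n X hX
      have h1 := hG.btw_inner (hAA n) (hAB (n + 1) (n + 1))
      have h2 := hG.btw_inner (hAA n) (hAB (n + 1) n)
      have h3 := hG.btw_inner (hAB n (n + 1)) (hBB n)
      rcases hX with rfl | rfl | hX
      · exact Or.inr (Or.inr h2)
      · exact Or.inr (Or.inr h3)
      · have h4 := hG.btw_inner' (hG.btw_symm _ _ _ hX) (hG.btw_symm _ _ _ h1)
        exact Or.inr (Or.inr (hG.btw_inner' (hG.btw_symm _ _ _ h4) h3)))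
  have key : ∀ n, u n ≤ l C X ∧ l C X ≤ v n := by
    intro n
    rw [← hAu, ← hBv]
    have h := hAB n n
    rcases hX n with rfl | rfl | hX
    · exact ⟨le_rfl, by rw [hl.add _ _ _ h]; linarith [hl.nonneg (A n) (B n)]⟩
    · exact ⟨by rw [hl.add _ _ _ h]; linarith [hl.nonneg (A n) (B n)], le_rfl⟩
    · have h1 := hG.btw_symm _ _ _ (hG.btw_inner (hG.btw_symm _ _ _ hX) (hG.btw_symm _ _ _ h))
      have h2 := hG.btw_outer h1 hX
      exact ⟨by rw [hl.add _ _ _ h1]; linarith [hl.nonneg (A n) X],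
        by rw [hl.add _ _ _ h2]; linarith [hl.nonneg X (B n)]⟩
  exact ⟨C, X, le_antisymm (ge_of_tendsto' hvt fun n => (key n).2)
    (le_of_tendsto' hut fun n => (key n).1)⟩

theorem exists_mem_ray (hl : G.IsLengthFunction I J l) (hG : G.IsEuclidean) {r : ℝ}
    (hr : 0 ≤ r) {O A : E} (hOA : O ≠ A) : ∃ X ∈ G.ray O A, l O X = r := by
  refine hl.exists_mem_ray_of_mem hG hr ?_ hOA
  rcases hr.eq_or_lt with rfl | hr
  · exact zero_mem _
  · obtain ⟨C, D, rfl⟩ := hl.exists_eq hG hr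
    exact hl.mem_valueGroup hG C D

/-- The points of a line correspond to the real numbers, with length and betweenness as in `ℝ`. -/
theorem exists_ruler (hl : G.IsLengthFunction I J l) (hG : G.IsEuclidean) {P Q : E} (hPQ : P ≠ Q) :
    ∃ f : ℝ → E, f 0 = P ∧ f (l P Q) = Q ∧ (∀ X, X ∈ G.line P Q ↔ ∃ t, f t = X) ∧
      (∀ s t, l (f s) (f t) = |s - t|) ∧
      ∀ s t u, G.Btw (f s) (f t) (f u) ↔ (s < t ∧ t < u) ∨ (u < t ∧ t < s) := by
  obtain ⟨R, hR⟩ := hG.btw_extend Q P hPQ.symm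
  have hPR := (hG.btw_ne hR).2.2
  have hline := hG.line_mem hPQ
  have hP := hG.left_mem_line P Q
  have hQ := hG.right_mem_line P Q
  have hRm := hG.mem_right hR hline hQ hP
  -- The ruler is glued from two opposite rays at `P`: `p` serves parameters `t ≥ 0`, `q` serves `t
  -- < 0`.
  choose p hp hpl using fun t : ℝ => hl.exists_mem_ray hG (abs_nonneg t) hPQ
  choose q hq hql using fun t : ℝ => hl.exists_mem_ray hG (abs_nonneg t) hPR
  have hpm : ∀ t, p t ∈ G.line P Q := fun t => ((hG.mem_ray_iff hPQ).1 (hp t)).1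
  have hqm : ∀ t, q t ∈ G.line P Q := fun t => by
    have := ((hG.mem_ray_iff hPR).1 (hq t)).1
    rwa [hG.line_eq hline hPR hP hRm] at this
  let f : ℝ → E := fun t => if 0 ≤ t then p t else q t
  have hfm : ∀ t, f t ∈ G.line P Q := fun t => by
    simp only [f]; split_ifs
    · exact hpm t
    · exact hqm t
  have hfp : ∀ t, 0 ≤ t → f t = p t := fun t ht => if_pos ht
  have hfq : ∀ t, t < 0 → f t = q t := fun t ht => if_neg (not_le.2 ht)
  have hray : ∀ O A : E, O ≠ A → ∀ X ∈ G.ray O A, ∀ Y ∈ G.ray O A, l X Y = |l O X - l O Y| := by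
    intro O A h X hX Y hY
    rcases hG.wbtw_or_of_mem_ray h hX hY with h' | h' <;> rw [hl.wbtw_add h']
    · rw [sub_add_cancel_left, abs_neg, abs_of_nonneg (hl.nonneg _ _)]
    · rw [add_sub_cancel_left, abs_of_nonneg (hl.nonneg _ _), hl.comm hG]
  have hopp : ∀ s t, 0 ≤ s → t < 0 → l (p s) (q t) = s - t := by
    intro s t hs ht
    rcases hs.eq_or_lt with rfl | hs
    · have : P = p 0 := hl.eq_of_zero (by rw [hpl, abs_zero])
      rw [← this, hql, abs_of_neg ht, zero_sub]
    · have hps : p s ≠ P := by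
        intro h; have := hpl s; rw [h, hl.degenerate, abs_of_pos hs] at this; exact hs.ne this
      have hqt : q t ≠ P := by
        intro h; have := hql t; rw [h, hl.degenerate, abs_of_neg ht] at this; linarith
      have h1 : G.Btw R P (p s) := hG.btw_of_not_btw hline hP hQ (hpm s) hps
        ((hG.mem_ray_iff hPQ).1 (hp s)).2 (hG.btw_symm _ _ _ hR)
      have h2 : G.Btw (p s) P (q t) := hG.btw_of_not_btw hline hP hRm (hqm t) hqt
        ((hG.mem_ray_iff hPR).1 (hq t)).2 (hG.btw_symm _ _ _ h1)
      rw [hl.add _ _ _ h2, hl.comm hG, hpl, hql, abs_of_pos hs, abs_of_neg ht]; ring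
  have hdist : ∀ s t, l (f s) (f t) = |s - t| := by
    intro s t
    rcases le_or_gt 0 s with hs | hs <;> rcases le_or_gt 0 t with ht | ht
    · rw [hfp s hs, hfp t ht, hray P Q hPQ _ (hp s) _ (hp t), hpl, hpl, abs_of_nonneg hs,
        abs_of_nonneg ht]
    · rw [hfp s hs, hfq t ht, hopp s t hs ht, abs_of_pos (by linarith)]
    · rw [hfp t ht, hfq s hs, hl.comm hG, hopp t s ht hs, abs_of_neg (by linarith)]; ring
    · rw [hfq s hs, hfq t ht, hray P R hPR _ (hq s) _ (hq t), hql, hql, abs_of_neg hs,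
        abs_of_neg ht, ← abs_neg]
      congr 1; ring
  have hinj : ∀ s t, s ≠ t → f s ≠ f t := fun s t hst h => by
    have := hdist s t
    rw [h, hl.degenerate] at this
    exact hst (sub_eq_zero.1 (abs_eq_zero.1 this.symm))
  -- Additivity of length forces the order of the parameters. The converse follows because one of
  -- three points lies between the others.
  have hbtw : ∀ s t u, G.Btw (f s) (f t) (f u) → (s < t ∧ t < u) ∨ (u < t ∧ t < s) := by
    intro s t u h
    have h1 := hl.add _ _ _ h
    have ne := hG.btw_ne h
    have n1 : s ≠ t := fun h => ne.1 (h ▸ rfl)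
    have n2 : t ≠ u := fun h => ne.2.2 (h ▸ rfl)
    rw [hdist, hdist, hdist] at h1
    rcases n1.lt_or_gt with h2 | h2 <;> rcases n2.lt_or_gt with h3 | h3
    · exact Or.inl ⟨h2, h3⟩
    · rw [abs_of_neg (sub_neg.2 h2), abs_of_pos (sub_pos.2 h3)] at h1
      rcases abs_cases (s - u) with h4 | h4 <;> linarith
    · rw [abs_of_pos (sub_pos.2 h2), abs_of_neg (sub_neg.2 h3)] at h1
      rcases abs_cases (s - u) with h4 | h4 <;> linarith
    · exact Or.inr ⟨h3, h2⟩
  have hf0 : f 0 = P := by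
    rw [hfp 0 le_rfl]; exact (hl.eq_of_zero (by rw [hpl, abs_zero])).symm
  refine ⟨f, hf0, ?_, fun X => ⟨fun hX => ?_, ?_⟩, hdist, fun s t u => ⟨hbtw s t u, fun h => ?_⟩⟩
  · rw [hfp _ (hl.nonneg _ _)]
    exact hl.eq_of_mem_ray hG hPQ (hp _) (Or.inr (Or.inl rfl))
      (by rw [hpl, abs_of_nonneg (hl.nonneg _ _)])
  · by_cases h : G.Btw X P Q
    · have hX0 := hl.pos P X (hG.btw_ne h).1.symm
      refine ⟨-l P X, ?_⟩
      rw [hfq _ (neg_lt_zero.2 hX0)]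
      refine hl.eq_of_mem_ray hG hPR (hq _) ((hG.mem_ray_iff hPR).2 ⟨?_, fun h' => ?_⟩)
        (by rw [hql, abs_neg, abs_of_pos hX0])
      · rwa [hG.line_eq hline hPR hP hRm]
      · exact hG.not_btw_of_btw_of_btw h hR h'
    · refine ⟨l P X, ?_⟩
      rw [hfp _ (hl.nonneg _ _)]
      exact hl.eq_of_mem_ray hG hPQ (hp _) ((hG.mem_ray_iff hPQ).2 ⟨hX, h⟩)
        (by rw [hpl, abs_of_nonneg (hl.nonneg _ _)])
  · rintro ⟨t, rfl⟩; exact hfm t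
  · have h1 : s ≠ t := by rcases h with h | h <;> [exact h.1.ne; exact h.2.ne']
    have h2 : t ≠ u := by rcases h with h | h <;> [exact h.2.ne; exact h.1.ne']
    have h3 : s ≠ u := by
      rcases h with h | h <;> [exact (h.1.trans h.2).ne; exact (h.1.trans h.2).ne']
    rcases hG.btw_trichotomy hline (hinj s t h1) (hinj s u h3) (hinj t u h2) (hfm s) (hfm t)
      (hfm u) with h4 | h4 | h4
    · exact h4
    · have := hbtw _ _ _ h4
      rcases h with h | h <;> rcases this with h5 | h5 <;> linarith
    · have := hbtw _ _ _ h4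
      rcases h with h | h <;> rcases this with h5 | h5 <;> linarith

end IsLengthFunction
end SyntheticGeometry

/-! ### Sides of a line, angles and side-angle-side -/

namespace SyntheticGeometry
variable {E : Type*} {G : SyntheticGeometry E}

variable (G) in
/-- The line `a` separates the points `X` and `Y`. -/
def Separates (a : Set E) (X Y : E) : Prop := ∃ Z ∈ a, G.Btw X Z Y

theorem Collin.swap {A B C : E} (h : G.Collin A B C) : G.Collin B A C :=
  let ⟨a, ha, h1, h2, h3⟩ := h; ⟨a, ha, h2, h1, h3⟩

theorem Collin.rev {A B C : E} (h : G.Collin A B C) : G.Collin C B A :=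
  let ⟨a, ha, h1, h2, h3⟩ := h; ⟨a, ha, h3, h2, h1⟩

theorem collin_iff {A B C : E} : G.Collin A B C ↔ C ∈ G.line A B := Iff.rfl

theorem Collin.rotate {A B C : E} (h : G.Collin A B C) : G.Collin B C A :=
  let ⟨a, ha, h1, h2, h3⟩ := h; ⟨a, ha, h2, h3, h1⟩

theorem angle_comm (A O B : E) : G.angle A O B = G.angle B O A := by
  have : G.plane A O B = G.plane B O A := by
    ext X
    exact ⟨fun ⟨α, h, h1, h2, h3, h4⟩ => ⟨α, h, h3, h2, h1, h4⟩,
      fun ⟨α, h, h1, h2, h3, h4⟩ => ⟨α, h, h3, h2, h1, h4⟩⟩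
  rw [angle, angle, this, Set.inter_comm]

namespace IsEuclidean

theorem ne_of_not_collin (hG : G.IsEuclidean) {A B C : E} (h : ¬ G.Collin A B C) :
    A ≠ B ∧ A ≠ C ∧ B ≠ C := by
  refine ⟨?_, ?_, ?_⟩ <;> rintro rfl
  · obtain ⟨a, ha, h1, h2⟩ := hG.exists_line A C
    exact h ⟨a, ha, h1, h1, h2⟩
  · obtain ⟨a, ha, h1, h2⟩ := hG.exists_line A B
    exact h ⟨a, ha, h1, h2, h1⟩
  · obtain ⟨a, ha, h1, h2⟩ := hG.exists_line A B
    exact h ⟨a, ha, h1, h2, h2⟩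

theorem plane_eq (hG : G.IsEuclidean) {A B C : E} (h : ¬ G.Collin A B C) {α : Set E}
    (hα : α ∈ G.planes) (hA : A ∈ α) (hB : B ∈ α) (hC : C ∈ α) : G.plane A B C = α := by
  ext X
  constructor
  · rintro ⟨β, hβ, h1, h2, h3, h4⟩
    rwa [(hG.existsUnique_plane A B C h).unique ⟨hα, hA, hB, hC⟩ ⟨hβ, h1, h2, h3⟩]
  · exact fun hX => ⟨α, hα, hA, hB, hC, hX⟩

theorem separates_symm (hG : G.IsEuclidean) {a : Set E} {X Y : E} (h : G.Separates a X Y) :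
    G.Separates a Y X :=
  let ⟨Z, hZ, h⟩ := h; ⟨Z, hZ, hG.btw_symm _ _ _ h⟩

/-- Being on the same side is transitive: this is Pasch's axiom for a proper triangle, and linear
order when the points are collinear. -/
theorem not_separates_trans (hG : G.IsEuclidean) {α a : Set E} (hα : α ∈ G.planes)
    (ha : a ∈ G.lines) (haα : a ⊆ α) {X Y Z : E} (hX : X ∈ α) (hY : Y ∈ α) (hZ : Z ∈ α)
    (hXa : X ∉ a) (hYa : Y ∉ a) (hZa : Z ∉ a) (h1 : ¬ G.Separates a X Y)
    (h2 : ¬ G.Separates a Y Z) : ¬ G.Separates a X Z := by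
  rintro ⟨W, hWa, hW⟩
  by_cases hc : G.Collin X Z Y
  · obtain ⟨b, hb, hXb, hZb, hYb⟩ := hc
    refine h1 ⟨W, hWa, hG.btw_of_not_btw hb (hG.mem_mid hW hb hXb hZb) hZb hYb
      (fun h => hYa (h ▸ hWa)) (fun h => h2 ⟨W, hWa, h⟩) hW⟩
  · rcases hG.pasch α hα X hX Z hZ Y hY hc a ha haα hXa hZa hYa ⟨W, hWa, hW⟩ with h | h
    · exact h1 h
    · exact h2 (hG.separates_symm h)

/-- Otherwise Pasch for the triangle `DFY` and the line `XZ`, entering at `H`, would put `X` between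
`D` and `Y` or `Z` between `F` and `Y`. -/
theorem not_btw_sides (hG : G.IsEuclidean) {α : Set E} (hα : α ∈ G.planes) {X Y Z D F H : E}
    (hX : X ∈ α) (hY : Y ∈ α) (hZ : Z ∈ α) (hc : ¬ G.Collin X Y Z) (hD : G.Btw X D Y)
    (hF : G.Btw Y F Z) (hH : G.Btw X H Z) : ¬ G.Btw D H F := by
  intro h
  have n := hG.ne_of_not_collin hc
  obtain ⟨a, ha, hDa, hHa, hFa⟩ := hG.btw_line h
  obtain ⟨b, hb, hXb, hDb, hYb⟩ := hG.btw_line hD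
  obtain ⟨d, hd, hYd, hFd, hZd⟩ := hG.btw_line hF
  obtain ⟨c, hcl, hXc, hHc, hZc⟩ := hG.btw_line hH
  have nD := hG.btw_ne hD
  have nF := hG.btw_ne hF
  have nH := hG.btw_ne hH
  have nh := hG.btw_ne h
  have hZb : Z ∉ b := fun h => hc ⟨b, hb, hXb, hYb, h⟩
  have hXd : X ∉ d := fun h => hc ⟨d, hd, h, hYd, hZd⟩
  have hYc : Y ∉ c := fun h => hc ⟨c, hcl, hXc, h, hZc⟩
  have un := hG.btw_unique
  have sy := hG.btw_symm
  have hYa : Y ∉ a := by grind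
  have hXa : X ∉ a := by grind
  have haα := hG.line_subset_plane a ha α hα D F nh.2.1 hDa hFa
    (hG.mem_plane_mid hD hα hX hY) (hG.mem_plane_mid hF hα hY hZ)
  rcases hG.pasch_line hα ha hcl haα X hDa hFa hY hYa h hHc hXc hX hXa hYc with
    ⟨W, hWc, hW⟩ | ⟨W, hWc, hW⟩
  · have := hG.mem_mid hW hb hDb hYb
    have : W = X := by grind
    grind
  · have := hG.mem_mid hW hd hFd hYd
    have : W = Z := by grind
    grind

/-- A line has only two sides. In a proper triangle, three crossing points on `a` would be distinct
with one of them between the others, which `not_btw_sides` excludes in each case. -/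
theorem not_separates_of_separates (hG : G.IsEuclidean) {α a : Set E} (hα : α ∈ G.planes)
    (ha : a ∈ G.lines) {X Y Z : E} (hX : X ∈ α) (hY : Y ∈ α) (hZ : Z ∈ α)
    (hXa : X ∉ a) (h1 : G.Separates a X Y) (h2 : G.Separates a Y Z) : ¬ G.Separates a X Z := by
  rintro ⟨H, hHa, hH⟩
  obtain ⟨D, hDa, hD⟩ := h1
  obtain ⟨F, hFa, hF⟩ := h2
  by_cases hc : G.Collin X Y Z
  · obtain ⟨b, hb, hXb, hYb, hZb⟩ := hc
    have hDb := hG.mem_mid hD hb hXb hYb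
    have hFb := hG.mem_mid hF hb hYb hZb
    have hHb := hG.mem_mid hH hb hXb hZb
    have h1 : D = F := by grind
    have h2 : D = H := by grind
    subst h1 h2
    exact hG.not_btw_of_btw_of_btw hD hF hH
  · obtain ⟨b, hb, hXb, hDb, hYb⟩ := hG.btw_line hD
    obtain ⟨d, hd, hYd, hFd, hZd⟩ := hG.btw_line hF
    obtain ⟨c, hcl, hXc, hHc, hZc⟩ := hG.btw_line hH
    have hZb : Z ∉ b := fun h => hc ⟨b, hb, hXb, hYb, h⟩
    have hXd : X ∉ d := fun h => hc ⟨d, hd, h, hYd, hZd⟩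
    have hYc : Y ∉ c := fun h => hc ⟨c, hcl, hXc, h, hZc⟩
    have nD := hG.btw_ne hD
    have nF := hG.btw_ne hF
    have nH := hG.btw_ne hH
    have n1 : D ≠ F := by grind
    have n2 : D ≠ H := by grind
    have n3 : F ≠ H := by grind
    have sy := hG.btw_symm
    rcases hG.btw_trichotomy ha n1 n2 n3 hDa hFa hHa with h | h | h
    · exact hG.not_btw_sides hα hY hX hZ (fun h => hc h.swap) (sy _ _ _ hD) hH hF h
    · exact hG.not_btw_sides hα hX hZ hY (fun h => hc h.rev.rotate.rotate) hH (sy _ _ _ hF)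
        hD (sy _ _ _ h)
    · exact hG.not_btw_sides hα hX hY hZ hc hD hF hH h

theorem mem_openHalfPlane (hG : G.IsEuclidean) {α a : Set E} {X B : E} (hB : B ∉ a) :
    X ∈ G.openHalfPlane α a B ↔ X ∈ α ∧ X ∉ a ∧ ¬ G.Separates a X B := by
  constructor
  · rintro ⟨h1, h2, rfl | h3⟩
    · exact ⟨h1, h2, fun ⟨Z, _, hZ⟩ => (hG.btw_ne hZ).2.1 rfl⟩
    · exact ⟨h1, h2, fun ⟨Z, hZa, hZ⟩ => h3 Z (Or.inr (Or.inr hZ)) hZa⟩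
  · rintro ⟨h1, h2, h3⟩
    refine ⟨h1, h2, Or.inr ?_⟩
    rintro Z (rfl | rfl | hZ) hZa
    · exact h2 hZa
    · exact hB hZa
    · exact h3 ⟨Z, hZa, hZ⟩

theorem ray_subset_line (hG : G.IsEuclidean) {O A : E} (h : O ≠ A) : G.ray O A ⊆ G.line O A :=
  fun _ hX => ((hG.mem_ray_iff h).1 hX).1

/-- A ray starting on a line and not contained in it stays on one side of the line. -/
theorem not_separates_ray (hG : G.IsEuclidean) {a : Set E} (ha : a ∈ G.lines) {O B X : E}
    (hO : O ∈ a) (hB : B ∉ a) (hX : X ∈ G.ray O B) (hXO : X ≠ O) :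
    X ∉ a ∧ ¬ G.Separates a X B := by
  have hOB : O ≠ B := fun h => hB (h ▸ hO)
  have h1 := hG.line_mem hOB
  have h2 := hG.left_mem_line O B
  have h3 := hG.right_mem_line O B
  obtain ⟨h4, h5⟩ := (hG.mem_ray_iff hOB).1 hX
  refine ⟨by grind, ?_⟩
  rintro ⟨Z, hZa, hZ⟩
  have := hG.mem_mid hZ h1 h4 h3
  have : Z = O := by grind
  exact h5 (this ▸ hZ)

theorem closedHalfPlane_congr (hG : G.IsEuclidean) {α a : Set E} (hα : α ∈ G.planes)
    (ha : a ∈ G.lines) (haα : a ⊆ α) {B B' : E} (hB : B ∈ α) (hB' : B' ∈ α) (hBa : B ∉ a)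
    (hBa' : B' ∉ a) (h : ¬ G.Separates a B B') :
    G.closedHalfPlane α a B = G.closedHalfPlane α a B' := by
  unfold closedHalfPlane
  congr 1
  ext X
  rw [hG.mem_openHalfPlane hBa, hG.mem_openHalfPlane hBa']
  refine and_congr_right fun h1 => and_congr_right fun h2 => ⟨fun h3 => ?_, fun h3 => ?_⟩
  · exact hG.not_separates_trans hα ha haα h1 hB hB' h2 hBa hBa' h3 h
  · exact hG.not_separates_trans hα ha haα h1 hB' hB h2 hBa' hBa h3
      fun h' => h (hG.separates_symm h')

theorem exists_plane_of_not_collin (hG : G.IsEuclidean) {A B C : E} (h : ¬ G.Collin A B C) :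
    ∃ α ∈ G.planes, A ∈ α ∧ B ∈ α ∧ C ∈ α := by
  obtain ⟨α, h, -⟩ := hG.existsUnique_plane A B C h
  exact ⟨α, h⟩

theorem not_collin_ray (hG : G.IsEuclidean) {A O B B' : E} (h : ¬ G.Collin A O B)
    (hB' : B' ∈ G.ray O B) (hne : B' ≠ O) : ¬ G.Collin A O B' := by
  have n := hG.ne_of_not_collin h
  rw [collin_iff] at h ⊢
  exact (hG.not_separates_ray (hG.line_mem n.1) (hG.right_mem_line A O) h hB' hne).1

/-- Angles are point sets, so moving `B` along its ray requires an equality of sets: the plane, the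
line `OB` and the side of `OA` all remain the same. -/
theorem angle_ray (hG : G.IsEuclidean) {A O B B' : E} (h : ¬ G.Collin A O B)
    (hB' : B' ∈ G.ray O B) (hne : B' ≠ O) : G.angle A O B' = G.angle A O B := by
  have h' := hG.not_collin_ray h hB' hne
  have n := hG.ne_of_not_collin h
  obtain ⟨α, hα, hA, hO, hB⟩ := hG.exists_plane_of_not_collin h
  have hl := hG.line_mem n.2.2
  have hB'l := hG.ray_subset_line n.2.2 hB'
  have hB'α := hG.line_subset hα n.2.2 hO hB hB'l
  have hlA := hG.line_mem n.1.symm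
  rw [collin_iff, line_comm] at h h'
  unfold angle
  rw [hG.plane_eq (by rwa [collin_iff, line_comm]) hα hA hO hB'α,
    hG.plane_eq (by rwa [collin_iff, line_comm]) hα hA hO hB,
    hG.line_eq hl hne.symm (hG.left_mem_line _ _) hB'l,
    hG.closedHalfPlane_congr hα hlA (hG.line_subset hα n.1.symm hO hA) hB'α hB h' h
      (hG.not_separates_ray hlA (hG.left_mem_line _ _) h hB' hne).2]

theorem angle_ray_left (hG : G.IsEuclidean) {A A' O B : E} (h : ¬ G.Collin A O B)
    (hA' : A' ∈ G.ray O A) (hne : A' ≠ O) : G.angle A' O B = G.angle A O B := by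
  rw [angle_comm A' O B, hG.angle_ray (fun hc => h hc.rev) hA' hne, angle_comm]

end IsEuclidean

namespace IsLengthFunction
variable {I J : E} {l : E → E → ℝ}

/-- Side-angle-side, with all three conclusions. -/
theorem side_angle_side (hl : G.IsLengthFunction I J l) (hG : G.IsEuclidean) {A B C A' B' C' : E}
    (h : ¬ G.Collin A B C) (h' : ¬ G.Collin A' B' C') (hAB : l A B = l A' B')
    (hAC : l A C = l A' C') (hang : G.AngCong (G.angle B A C) (G.angle B' A' C')) :
    l B C = l B' C' ∧ G.AngCong (G.angle A B C) (G.angle A' B' C') ∧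
      G.AngCong (G.angle A C B) (G.angle A' C' B') := by
  have n := hG.ne_of_not_collin h
  have n' := hG.ne_of_not_collin h'
  have h1 := hG.side_angle_side A B C A' B' C' h h' (hl.segCong_of_eq hG n.1 n'.1 hAB)
    (hl.segCong_of_eq hG n.2.1 n'.2.1 hAC) hang
  refine ⟨?_, h1⟩
  -- The axiom gives angles only. With `D` on the ray `B'C'` at distance `BC`, the axiom at `B`
  -- makes the angles `BAC` and `B'A'D` congruent. Uniqueness of laying off angles puts `D` on
  -- `A'C'`, so `D = C'`.
  obtain ⟨D, hD, hDl⟩ := hl.exists_mem_ray hG (hl.nonneg B C) n'.2.2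
  have hDB : D ≠ B' := by
    rintro rfl
    rw [hl.degenerate] at hDl
    exact (hl.pos _ _ n.2.2).ne hDl
  have h2 := h1.1
  rw [← hG.angle_ray h' hD hDB] at h2
  have h3 : ¬ G.Collin A' B' D := hG.not_collin_ray h' hD hDB
  have h4 := (hG.side_angle_side B A C B' A' D (fun hc => h hc.swap) (fun hc => h3 hc.swap)
    (hl.segCong_of_eq hG n.1.symm n'.1.symm (by rw [hl.comm hG, hAB, hl.comm hG]))
    (hl.segCong_of_eq hG n.2.2 hDB.symm hDl.symm) h2).1
  have hBAC : ¬ G.Collin B' A' C' := fun hc => h' hc.swap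
  have hl1 := hG.line_mem n'.1
  have hC1 : C' ∉ G.line A' B' := by rwa [← collin_iff]
  obtain ⟨α, hα, hA, hB, hC⟩ := hG.exists_plane_of_not_collin h'
  have hDm := hG.ray_subset_line n'.2.2 hD
  have hs := hG.not_separates_ray hl1 (hG.right_mem_line _ _) hC1 hD hDB
  have key := (hG.angle_transfer B A C B' A' C' (fun hc => h hc.swap) hBAC).unique
    ⟨C', (hG.mem_openHalfPlane hC1).2 ⟨by rwa [hG.plane_eq hBAC hα hB hA hC], hC1,
      fun ⟨Z, _, hZ⟩ => (hG.btw_ne hZ).2.1 rfl⟩, rfl, hang⟩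
    ⟨D, (hG.mem_openHalfPlane hC1).2 ⟨by
      rw [hG.plane_eq hBAC hα hB hA hC]; exact hG.line_subset hα n'.2.2 hB hC hDm,
      hs⟩, rfl, h4⟩
  have hDC : D = C' := by
    have hD2 : D ∈ G.line A' C' := hG.ray_subset_line n'.2.1 (key ▸ Or.inr (Or.inl rfl))
    have := hG.line_mem n'.2.2
    have := hG.line_mem n'.2.1
    have := hG.right_mem_line A' C'
    have := hG.right_mem_line B' C'
    have := hG.left_mem_line A' C'
    have := hG.left_mem_line B' C'
    have := hG.left_mem_line A' B'
    have := hG.right_mem_line A' B'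
    grind
  rw [← hDC, hDl]

end IsLengthFunction
end SyntheticGeometry

/-! ### Midpoints, vertical angles and point reflections -/

namespace SyntheticGeometry
variable {E : Type*} {G : SyntheticGeometry E}

variable (G) in
/-- `M` is the midpoint of `A` and `B`, which are distinct. -/
def Mid (l : E → E → ℝ) (A M B : E) : Prop := G.Btw A M B ∧ l A M = l M B

namespace IsLengthFunction
variable {I J : E} {l : E → E → ℝ}

theorem mid_symm (hl : G.IsLengthFunction I J l) (hG : G.IsEuclidean) {A M B : E}
    (h : G.Mid l A M B) : G.Mid l B M A :=
  ⟨hG.btw_symm _ _ _ h.1, by rw [hl.comm hG, ← h.2, hl.comm hG]⟩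

theorem exists_reflection (hl : G.IsLengthFunction I J l) (hG : G.IsEuclidean) {A M : E}
    (h : A ≠ M) : ∃ B, G.Mid l A M B := by
  obtain ⟨f, h0, h1, -, hd, hb⟩ := hl.exists_ruler hG h
  have hp := hl.pos A M h
  refine ⟨f (2 * l A M), ?_, ?_⟩
  · have := (hb 0 (l A M) (2 * l A M)).2 (Or.inl ⟨hp, by linarith⟩)
    rwa [h0, h1] at this
  · have := hd (l A M) (2 * l A M)
    rw [h1] at this
    rw [this, abs_sub_comm, abs_of_pos (by linarith)]; ring

theorem exists_mid (hl : G.IsLengthFunction I J l) (hG : G.IsEuclidean) {A B : E}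
    (h : A ≠ B) : ∃ M, G.Mid l A M B := by
  obtain ⟨f, h0, h1, -, hd, hb⟩ := hl.exists_ruler hG h
  have hp := hl.pos A B h
  refine ⟨f (l A B / 2), ?_, ?_⟩
  · have := (hb 0 (l A B / 2) (l A B)).2 (Or.inl ⟨by linarith, by linarith⟩)
    rwa [h0, h1] at this
  · have h2 := hd 0 (l A B / 2)
    have h3 := hd (l A B / 2) (l A B)
    rw [h0, abs_of_neg (by linarith)] at h2
    rw [h1, abs_of_neg (by linarith)] at h3
    rw [h2, h3]; ring

theorem mid_unique (hl : G.IsLengthFunction I J l) (hG : G.IsEuclidean) {A M B B' : E}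
    (h : G.Mid l A M B) (h' : G.Mid l A M B') : B = B' := by
  have n := hG.btw_ne h.1
  have n' := hG.btw_ne h'.1
  refine hl.eq_of_mem_ray hG n.2.2 (Or.inr (Or.inl rfl)) ?_ (h.2.symm.trans h'.2)
  obtain ⟨a, ha, hA, hM, hB⟩ := hG.btw_line h.1
  rw [hG.mem_ray_iff n.2.2, hG.line_eq ha n.2.2 hM hB]
  exact ⟨hG.mem_right h'.1 ha hA hM,
    fun hc => hG.not_btw_of_btw_of_btw h'.1 hc h.1⟩

/-- Vertical angles are congruent: the case of points at equal distances from the vertex. -/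
theorem vertical_angle_of_eq (hl : G.IsLengthFunction I J l) (hG : G.IsEuclidean)
    {O A B A' B' : E} (h : ¬ G.Collin A O B) (hA : G.Btw A O A') (hB : G.Btw B O B')
    (h1 : l O A' = l O A) (h2 : l O B = l O A) (h3 : l O B' = l O A) :
    G.AngCong (G.angle A' O B') (G.angle A O B) := by
  have n := hG.ne_of_not_collin h
  have nA := hG.btw_ne hA
  have nB := hG.btw_ne hB
  obtain ⟨a, ha, haA, haO, haA'⟩ := hG.btw_line hA
  obtain ⟨b, hb, hbB, hbO, hbB'⟩ := hG.btw_line hB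
  have hBa : B ∉ a := fun hc => h ⟨a, ha, haA, haO, hc⟩
  have hAb : A ∉ b := fun hc => h ⟨b, hb, hc, hbO, hbB⟩
  have hB'a : B' ∉ a := by grind
  have hA'b : A' ∉ b := by grind
  have rA : O ∈ G.ray A A' := Or.inr (Or.inr (Or.inl hA))
  have rA' : O ∈ G.ray A' A := Or.inr (Or.inr (Or.inl (hG.btw_symm _ _ _ hA)))
  have rB : O ∈ G.ray B B' := Or.inr (Or.inr (Or.inl hB))
  have rB' : O ∈ G.ray B' B := Or.inr (Or.inr (Or.inl (hG.btw_symm _ _ _ hB)))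
  have cm := hl.comm hG
  have c1 := hG.not_collin ha nA.1.symm haO haA hB'a
  have c2 := hG.not_collin hb nB.2.2 hbO hbB' hAb
  -- The isosceles triangle `OAB'` is compared with its own mirror image, which gives equal base
  -- angles.
  have s1 := hl.side_angle_side hG c1 c2 h3.symm h3
    (by rw [angle_comm B' O A]; exact hG.angCong_refl _ _ _ fun hc => c1 hc.swap)
  have c3 := hG.not_collin ha nA.2.1 haA haA' hB'a
  have c4 := hG.not_collin hb nB.2.1.symm hbB' hbB hAb
  -- By these base angles `AA'B'` and `B'BA` are congruent, hence `A'B' = BA` with equal angles at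
  -- `A'` and `B`; a last comparison of `A'OB'` with `BOA` yields the vertical angles.
  have s2 := hl.side_angle_side hG c3 c4
    (by rw [hl.add _ _ _ hA, cm B' B, hl.add _ _ _ hB, cm A O, cm B O]; linarith) (cm _ _) (by
      rw [← hG.angle_ray_left (fun hc => c3 hc.swap) rA nA.1.symm,
        ← hG.angle_ray_left (fun hc => c4 hc.swap) rB' nB.2.2]
      exact s1.2.1)
  have c5 := hG.not_collin ha nA.2.2.symm haA' haO hB'a
  have c6 := hG.not_collin hb nB.1 hbB hbO hAb
  have s3 := hl.side_angle_side hG c5 c6 (by rw [cm A' O, cm B O]; linarith) s2.1 (by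
      have c7 := hG.not_collin ha nA.2.1 haA haA' hB'a
      have c8 := hG.not_collin hb nB.2.1.symm hbB' hbB hAb
      rw [hG.angle_ray_left c7 rA' nA.2.2, hG.angle_ray_left c8 rB nB.1.symm]
      exact s2.2.1)
  rw [angle_comm A O B]
  exact s3.2.1

/-- Vertical angles are congruent. -/
theorem vertical_angle (hl : G.IsLengthFunction I J l) (hG : G.IsEuclidean) {O A B A' B' : E}
    (h : ¬ G.Collin A O B) (hA : G.Btw A O A') (hB : G.Btw B O B') :
    G.AngCong (G.angle A' O B') (G.angle A O B) := by
  have n := hG.ne_of_not_collin h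
  have unit : ∀ X X', G.Btw X O X' → ∃ Y Y', Y ∈ G.ray O X ∧ Y' ∈ G.ray O X' ∧ Y ≠ O ∧ Y' ≠ O ∧
      l O Y = 1 ∧ l O Y' = 1 ∧ G.Btw Y O Y' := by
    intro X X' hX
    have nX := hG.btw_ne hX
    obtain ⟨a, ha, hXa, hOa, hXa'⟩ := hG.btw_line hX
    obtain ⟨Y, h1, h2⟩ := hl.exists_mem_ray hG zero_le_one nX.1.symm
    obtain ⟨Y', h1', h2'⟩ := hl.exists_mem_ray hG zero_le_one nX.2.2
    have h3 : Y ≠ O := fun h => by rw [h, hl.degenerate] at h2; exact zero_ne_one h2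
    have h3' : Y' ≠ O := fun h => by rw [h, hl.degenerate] at h2'; exact zero_ne_one h2'
    refine ⟨Y, Y', h1, h1', h3, h3', h2, h2', ?_⟩
    rw [hG.mem_ray_iff nX.1.symm, hG.line_eq ha nX.1.symm hOa hXa] at h1
    rw [hG.mem_ray_iff nX.2.2, hG.line_eq ha nX.2.2 hOa hXa'] at h1'
    have h4 := hG.btw_of_not_btw ha hOa hXa h1.1 h3 h1.2 (hG.btw_symm _ _ _ hX)
    exact hG.btw_of_not_btw ha hOa hXa' h1'.1 h3' h1'.2 (hG.btw_symm _ _ _ h4)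
  obtain ⟨P, P', hP, hP', hPO, hPO', hPl, hPl', hPP⟩ := unit A A' hA
  obtain ⟨Q, Q', hQ, hQ', hQO, hQO', hQl, hQl', hQQ⟩ := unit B B' hB
  obtain ⟨a, ha, haA, haO, haA'⟩ := hG.btw_line hA
  obtain ⟨b, hb, hbB, hbO, hbB'⟩ := hG.btw_line hB
  have nA := hG.btw_ne hA
  have nB := hG.btw_ne hB
  have hBa : B ∉ a := fun hc => h ⟨a, ha, haA, haO, hc⟩
  have c1 : ¬ G.Collin A O Q := hG.not_collin_ray h hQ hQO
  have c2 : ¬ G.Collin P O Q := fun hc =>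
    hG.not_collin_ray (fun hc => c1 hc.rev) hP hPO hc.rev
  have c3 : ¬ G.Collin A' O B' := hG.not_collin ha nA.2.2.symm haA' haO (by grind)
  have c4 : ¬ G.Collin A' O Q' := hG.not_collin_ray c3 hQ' hQO'
  have := hl.vertical_angle_of_eq hG c2 hPP hQQ (by rw [hPl, hPl']) (by rw [hPl, hQl])
    (by rw [hPl, hQl'])
  rwa [hG.angle_ray_left c1 hP hPO, hG.angle_ray h hQ hQO, hG.angle_ray_left c4 hP' hPO',
    hG.angle_ray c3 hQ' hQO'] at this

/-- A point reflection preserves lengths, and the angles of a triangle with the centre. -/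
theorem reflection_congr (hl : G.IsLengthFunction I J l) (hG : G.IsEuclidean) {C A B A' B' : E}
    (h : ¬ G.Collin A C B) (hA : G.Mid l A C A') (hB : G.Mid l B C B') :
    l A' B' = l A B ∧ G.AngCong (G.angle C A B) (G.angle C A' B') := by
  have h' : ¬ G.Collin A' C B' := by
    obtain ⟨a, ha, haA, haO, haA'⟩ := hG.btw_line hA.1
    obtain ⟨b, hb, hbB, hbO, hbB'⟩ := hG.btw_line hB.1
    have nA := hG.btw_ne hA.1
    have nB := hG.btw_ne hB.1
    have hBa : B ∉ a := fun hc => h ⟨a, ha, haA, haO, hc⟩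
    exact hG.not_collin ha nA.2.2.symm haA' haO (by grind)
  have cm := hl.comm hG
  have s := hl.side_angle_side hG (fun hc => h hc.swap) (fun hc => h' hc.swap)
    (by rw [cm C A, hA.2]) (by rw [cm C B, hB.2])
    (hl.vertical_angle hG h' (hG.btw_symm _ _ _ hA.1) (hG.btw_symm _ _ _ hB.1))
  exact ⟨s.1.symm, s.2.1⟩

/-- `B` and `D` are on one side of `AC`, so `B'` and `D'` are both on the other. The angles `CA'B'`
and `CA'D'` are congruent to the same angle at `A`, so uniqueness of laying off angles identifies
the rays `A'B'` and `A'D'`. -/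
theorem reflection_collin_of_btw (hl : G.IsLengthFunction I J l) (hG : G.IsEuclidean)
    {C A B D A' B' D' : E} {b : Set E} (hb : b ∈ G.lines) (hC : C ∉ b) (hAb : A ∈ b) (hBb : B ∈ b)
    (hABD : G.Btw A B D) (hA : G.Mid l A C A') (hB : G.Mid l B C B') (hD : G.Mid l D C D') :
    G.Collin A' B' D' := by
  have n := hG.btw_ne hABD
  have hDb := hG.mem_right hABD hb hAb hBb
  have nA := hG.btw_ne hA.1
  have nB := hG.btw_ne hB.1
  have nD := hG.btw_ne hD.1
  have c1 : ¬ G.Collin A C B := fun hc => hG.not_collin hb n.1 hAb hBb hC hc.rev.rotate.rotate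
  have c2 : ¬ G.Collin A C D := fun hc => hG.not_collin hb n.2.1 hAb hDb hC hc.rev.rotate.rotate
  obtain ⟨a, ha, haA, haC, haA'⟩ := hG.btw_line hA.1
  have hBa : B ∉ a := fun hc => c1 ⟨a, ha, haA, haC, hc⟩
  have hDa : D ∉ a := fun hc => c2 ⟨a, ha, haA, haC, hc⟩
  obtain ⟨d, hd, hdB, hdC, hdB'⟩ := hG.btw_line hB.1
  obtain ⟨e, he, heD, heC, heD'⟩ := hG.btw_line hD.1
  have hB'a : B' ∉ a := by grind
  have hD'a : D' ∉ a := by grind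
  obtain ⟨α, hα, hbα, hCα⟩ := hG.exists_plane hb hC
  have hA'α := hG.mem_plane_right hA.1 hα (hbα hAb) hCα
  have hB'α := hG.mem_plane_right hB.1 hα (hbα hBb) hCα
  have hD'α := hG.mem_plane_right hD.1 hα (hbα hDb) hCα
  have haα := hG.line_subset_plane a ha α hα A C nA.1 haA haC (hbα hAb) hCα
  have c3 : ¬ G.Collin C A' B' := hG.not_collin ha nA.2.2 haC haA' hB'a
  have hsep : ¬ G.Separates a D' B' := by
    have h1 : ¬ G.Separates a B D := fun ⟨Z, hZa, hZ⟩ => by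
      have := hG.mem_mid hZ hb hBb hDb
      have : Z = A := by grind
      subst this
      exact (hG.btw_unique _ _ _ hABD).2 (hG.btw_symm _ _ _ hZ)
    intro h2
    have h3 := hG.not_separates_of_separates hα ha (hbα hDb) hD'α hB'α hDa ⟨C, haC, hD.1⟩ h2
    exact hG.not_separates_trans hα ha haα (hbα hBb) (hbα hDb) hB'α hBa hDa hB'a h1 h3
      ⟨C, haC, hB.1⟩
  have hline : G.line A' C = a := hG.line_eq ha nA.2.2.symm haA' haC
  have ang : G.angle C A D = G.angle C A B :=
    hG.angle_ray (fun hc => c1 hc.swap) (Or.inr (Or.inr (Or.inr hABD))) n.2.1.symm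
  have hBh : B' ∉ G.line A' C := hline ▸ hB'a
  have key := (hG.angle_transfer C A B C A' B' (fun hc => c1 hc.swap) c3).unique
    ⟨B', (hG.mem_openHalfPlane hBh).2 ⟨by rwa [hG.plane_eq c3 hα hCα hA'α hB'α], hBh,
      fun ⟨Z, _, hZ⟩ => (hG.btw_ne hZ).2.1 rfl⟩, rfl, (hl.reflection_congr hG c1 hA hB).2⟩
    ⟨D', (hG.mem_openHalfPlane hBh).2 ⟨by rwa [hG.plane_eq c3 hα hCα hA'α hB'α],
      by rwa [hline], by rwa [hline]⟩, rfl, ang ▸ (hl.reflection_congr hG c2 hA hD).2⟩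
  have : D' ∈ G.ray A' B' := key ▸ Or.inr (Or.inl rfl)
  exact hG.ray_subset_line (hG.ne_of_not_collin c3).2.2 this

end IsLengthFunction
end SyntheticGeometry

/-! ### Parallels and the midline of a triangle -/

namespace SyntheticGeometry
variable {E : Type*} {G : SyntheticGeometry E}

theorem Parallel.symm {a b : Set E} (h : G.Parallel a b) : G.Parallel b a := by
  rcases h with rfl | ⟨⟨α, hα, h1, h2⟩, h⟩
  · exact Or.inl rfl
  · exact Or.inr ⟨⟨α, hα, h2, h1⟩, by rwa [Set.inter_comm]⟩

theorem Parallel.eq_of_mem {a b : Set E} (h : G.Parallel a b) {P : E} (ha : P ∈ a) (hb : P ∈ b) :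
    a = b := by
  rcases h with h | ⟨-, h⟩
  · exact h
  · exact absurd h (Set.nonempty_iff_ne_empty.1 ⟨P, ha, hb⟩)

namespace IsEuclidean

theorem parallel_unique (hG : G.IsEuclidean) {a b c : Set E} (ha : a ∈ G.lines) (hb : b ∈ G.lines)
    (hc : c ∈ G.lines) {P : E} (hPb : P ∈ b) (hPc : P ∈ c) (h1 : G.Parallel b a)
    (h2 : G.Parallel c a) : b = c := by
  by_cases h : P ∈ a
  · rw [h1.eq_of_mem hPb h, h2.eq_of_mem hPc h]
  · exact (hG.existsUnique_parallel a ha P h).unique ⟨hb, hPb, h1⟩ ⟨hc, hPc, h2⟩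

theorem exists_parallel (hG : G.IsEuclidean) {a : Set E} (ha : a ∈ G.lines) (P : E) :
    ∃ b ∈ G.lines, P ∈ b ∧ G.Parallel b a := by
  by_cases h : P ∈ a
  · exact ⟨a, ha, h, Or.inl rfl⟩
  · exact (hG.existsUnique_parallel a ha P h).exists

theorem parallel_trans (hG : G.IsEuclidean) {α a b c : Set E} (hα : α ∈ G.planes)
    (ha : a ∈ G.lines) (hb : b ∈ G.lines) (hc : c ∈ G.lines) (haα : a ⊆ α) (hcα : c ⊆ α)
    (h1 : G.Parallel a b) (h2 : G.Parallel b c) : G.Parallel a c := by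
  by_cases h : (a ∩ c).Nonempty
  · obtain ⟨P, hP1, hP2⟩ := h
    exact Or.inl (hG.parallel_unique hb ha hc hP1 hP2 h1 h2.symm)
  · exact Or.inr ⟨⟨α, hα, haα, hcα⟩, Set.not_nonempty_iff_eq_empty.1 h⟩

/-- A parallel to a line of a plane through a point of that plane lies in the plane. -/
theorem parallel_subset (hG : G.IsEuclidean) {α a b : Set E} (hα : α ∈ G.planes)
    (ha : a ∈ G.lines) (haα : a ⊆ α) {P : E} (hPα : P ∈ α) (hPb : P ∈ b)
    (h : G.Parallel b a) : b ⊆ α := by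
  rcases h with rfl | ⟨⟨β, hβ, h1, h2⟩, h⟩
  · exact haα
  · obtain ⟨A, B, hAB, hA, hB⟩ := hG.line_two_points a ha
    have hPa : P ∉ a := fun hc => (h ▸ ⟨hPb, hc⟩ : P ∈ (∅ : Set E))
    have : α = β := (hG.existsUnique_plane A B P (hG.not_collin ha hAB hA hB hPa)).unique
      ⟨hα, haα hA, haα hB, hPα⟩ ⟨hβ, h2 hA, h2 hB, h1 hPb⟩
    rwa [this]

end IsEuclidean

namespace IsLengthFunction
variable {I J : E} {l : E → E → ℝ}

theorem reflection_mem_line (hl : G.IsLengthFunction I J l) (hG : G.IsEuclidean)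
    {C A B D A' B' D' : E} {b : Set E} (hb : b ∈ G.lines) (hC : C ∉ b) (hAb : A ∈ b) (hBb : B ∈ b)
    (hDb : D ∈ b) (hAB : A ≠ B) (hA : G.Mid l A C A') (hB : G.Mid l B C B')
    (hD : G.Mid l D C D') : D' ∈ G.line A' B' := by
  by_cases h1 : A = D
  · subst h1
    rw [hl.mid_unique hG hD hA]; exact hG.left_mem_line _ _
  by_cases h2 : B = D
  · subst h2
    rw [hl.mid_unique hG hD hB]; exact hG.right_mem_line _ _
  rcases hG.btw_trichotomy hb hAB h1 h2 hAb hBb hDb with h | h | h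
  · exact hl.reflection_collin_of_btw hG hb hC hAb hBb h hA hB hD
  · exact (hl.reflection_collin_of_btw hG hb hC hBb hAb h hB hA hD).swap
  · exact (hl.reflection_collin_of_btw hG hb hC hAb hDb h hA hD hB).rotate.rev

/-- A point reflection takes a line that misses the centre to a parallel line. -/
theorem exists_reflection_line (hl : G.IsLengthFunction I J l) (hG : G.IsEuclidean) {C A A' : E}
    {b : Set E} (hb : b ∈ G.lines) (hC : C ∉ b) (hAb : A ∈ b) (hA : G.Mid l A C A') :
    ∃ b' ∈ G.lines, A' ∈ b' ∧ C ∉ b' ∧ G.Parallel b' b ∧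
      ∀ P P', P ∈ b → G.Mid l P C P' → P' ∈ b' := by
  obtain ⟨B, hBb, hAB⟩ : ∃ B ∈ b, A ≠ B := by
    obtain ⟨K, L, h, hK, hL⟩ := hG.line_two_points b hb
    by_cases h1 : A = K
    · exact ⟨L, hL, h1 ▸ h⟩
    · exact ⟨K, hK, h1⟩
  obtain ⟨B', hB⟩ := hl.exists_reflection hG (A := B) (M := C) (fun h => hC (h ▸ hBb))
  have nA := hG.btw_ne hA.1
  have nB := hG.btw_ne hB.1
  obtain ⟨d, hd, hdA, hdC, hdA'⟩ := hG.btw_line hA.1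
  obtain ⟨e, he, heB, heC, heB'⟩ := hG.btw_line hB.1
  have hAB' : A' ≠ B' := by grind
  have hb' := hG.line_mem hAB'
  have m1 := hG.left_mem_line A' B'
  have m2 := hG.right_mem_line A' B'
  have hCb' : C ∉ G.line A' B' := by grind
  obtain ⟨α, hα, hbα, hCα⟩ := hG.exists_plane hb hC
  have hb'α := hG.line_subset hα hAB' (hG.mem_plane_right hA.1 hα (hbα hAb) hCα)
    (hG.mem_plane_right hB.1 hα (hbα hBb) hCα)
  refine ⟨_, hb', m1, hCb', Or.inr ⟨⟨α, hα, hb'α, hbα⟩, ?_⟩,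
    fun P P' hP hPP => hl.reflection_mem_line hG hb hC hAb hBb hP hAB hA hB hPP⟩
  -- The reflection of a common point `W` would again lie on `b`, by reflecting the image line back,
  -- and then `C`, between the two, would lie on `b`.
  by_contra hne
  obtain ⟨W, hW', hW⟩ := Set.nonempty_iff_ne_empty.2 hne
  obtain ⟨V, hV⟩ := hl.exists_reflection hG (A := W) (M := C) (fun h => hC (h ▸ hW))
  have h1 := hl.reflection_mem_line hG hb' hCb' m1 m2 hW' hAB' (hl.mid_symm hG hA)
    (hl.mid_symm hG hB) hV
  rw [hG.line_eq hb hAB hAb hBb] at h1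
  exact hC (hG.mem_mid hV.1 hb hW h1)

/-- The reflection in the midpoint of a segment connecting two parallels exchanges them. -/
theorem reflection_mem_parallel (hl : G.IsLengthFunction I J l) (hG : G.IsEuclidean)
    {a b : Set E} {A B C P P' : E} (ha : a ∈ G.lines) (hb : b ∈ G.lines) (h : G.Parallel a b)
    (hC : C ∉ a) (hA : A ∈ a) (hB : B ∈ b) (hAB : G.Mid l A C B) (hP : P ∈ a)
    (hPP : G.Mid l P C P') : P' ∈ b := by
  obtain ⟨a', ha', hBa', -, hpar, hmem⟩ := hl.exists_reflection_line hG ha hC hA hAB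
  rw [hG.parallel_unique ha hb ha' hB hBa' h.symm hpar]
  exact hmem P P' hP hPP

/-- The line through the midpoints of two sides of a triangle is parallel to the third side. -/
theorem midline (hl : G.IsLengthFunction I J l) (hG : G.IsEuclidean) {R P Q A B : E}
    (h : ¬ G.Collin R P Q) (hA : G.Mid l R A P) (hB : G.Mid l R B Q) :
    G.Parallel (G.line A B) (G.line P Q) := by
  have n := hG.ne_of_not_collin h
  have nA := hG.btw_ne hA.1
  have nB := hG.btw_ne hB.1
  obtain ⟨α, hα, hRα, hPα, hQα⟩ := hG.exists_plane_of_not_collin h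
  have hAα := hG.mem_plane_mid hA.1 hα hRα hPα
  have hBα := hG.mem_plane_mid hB.1 hα hRα hQα
  obtain ⟨a, ha, haR, haA, haP⟩ := hG.btw_line hA.1
  obtain ⟨b, hb, hbR, hbB, hbQ⟩ := hG.btw_line hB.1
  have hQa : Q ∉ a := fun hc => h ⟨a, ha, haR, haP, hc⟩
  have hPb : P ∉ b := fun hc => h ⟨b, hb, hbR, hc, hbQ⟩
  have hBa : B ∉ a := by grind
  have hAB : A ≠ B := by grind
  have hAQ : A ≠ Q := by grind
  obtain ⟨D, hD⟩ := hl.exists_reflection hG hAB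
  obtain ⟨C, hC⟩ := hl.exists_mid hG hAQ
  have nD := hG.btw_ne hD.1
  have nC := hG.btw_ne hC.1
  obtain ⟨c, hc, hcA, hcC, hcQ⟩ := hG.btw_line hC.1
  obtain ⟨d, hd, hdA, hdB, hdD⟩ := hG.btw_line hD.1
  have hcα := hG.line_subset_plane c hc α hα A Q hAQ hcA hcQ hAα hQα
  have hRc : R ∉ c := by grind
  have hPc : P ∉ c := by grind
  have hBc : B ∉ c := by grind
  have hDc : D ∉ c := by grind
  have hCa : C ∉ a := by grind
  have hPC : P ≠ C := by grind
  -- The aim is `X = D`. Both points lie on the parallel `a'` to `RP` through `Q`, on the same side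
  -- of `AQ`, with `QX = AP = RA = QD`. Then the reflection in `C` maps the line `PQ` to the line
  -- `AD`, which is `AB`.
  obtain ⟨X, hX⟩ := hl.exists_reflection hG hPC
  obtain ⟨a', ha', hDa', -, hpar, hmem⟩ := hl.exists_reflection_line hG ha hBa haA hD
  have hQa' := hmem R Q haR hB
  have hXa' := hl.reflection_mem_parallel hG ha ha' hpar.symm hCa haA hQa' hC haP hX
  have nX := hG.btw_ne hX.1
  obtain ⟨e, he, heP, heC, heX⟩ := hG.btw_line hX.1
  have hXc : X ∉ c := by grind
  have hDα := hG.mem_plane_right hD.1 hα hAα hBα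
  have hXα := hG.mem_plane_right hX.1 hα hPα (hcα hcC)
  have s1 : ¬ G.Separates c R X :=
    hG.not_separates_of_separates hα hc hRα hPα hXα hRc ⟨A, hcA, hA.1⟩ ⟨C, hcC, hX.1⟩
  have s2 : ¬ G.Separates c R B :=
    (hG.not_separates_ray hc hcQ hBc
      (Or.inr (Or.inr (Or.inr (hG.btw_symm _ _ _ hB.1)))) n.2.1).2
  have s3 : ¬ G.Separates c D B :=
    (hG.not_separates_ray hc hcA hBc (Or.inr (Or.inr (Or.inr hD.1))) nD.2.1.symm).2
  have s4 : ¬ G.Separates c X D :=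
    hG.not_separates_trans hα hc hcα hXα hRα hDα hXc hRc hDc (fun h => s1 (hG.separates_symm h))
      (hG.not_separates_trans hα hc hcα hRα hBα hDα hRc hBc hDc s2
        fun h => s3 (hG.separates_symm h))
  have hQD : Q ≠ D := fun h => hDc (h ▸ hcQ)
  have hXD : X = D := by
    refine hl.eq_of_mem_ray hG hQD ((hG.mem_ray_iff hQD).2 ⟨?_, fun h => s4 ⟨Q, hcQ, h⟩⟩)
      (Or.inr (Or.inl rfl)) ?_
    · rwa [hG.line_eq ha' hQD hQa' hDa']
    · have cA : ¬ G.Collin A C P := hG.not_collin hc nC.1 hcA hcC hPc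
      have cB : ¬ G.Collin R B A := fun hc => by
        obtain ⟨x, hx, h1, h2, h3⟩ := hc
        grind
      rw [(hl.reflection_congr hG cA hC hX).1, (hl.reflection_congr hG cB hB hD).1, hA.2]
  subst hXD
  have hp := hG.line_mem n.2.2
  have p1 := hG.left_mem_line P Q
  have p2 := hG.right_mem_line P Q
  have hCp : C ∉ G.line P Q := by grind
  obtain ⟨p', hp', hAp', -, hpar', hmem'⟩ :=
    hl.exists_reflection_line hG hp hCp p2 (hl.mid_symm hG hC)
  have hXp' := hmem' P X p1 hX
  have : p' = d := by grind
  rw [hG.line_eq hd hAB hdA hdB, ← this]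
  exact hpar'

end IsLengthFunction
end SyntheticGeometry

/-! ### Additive functions and affine parametrizations of lines -/

/-- An additive function on `ℝ` that is positive on positive numbers and takes `1` to `1` is the
identity. -/
theorem eq_id_of_add_of_pos {g : ℝ → ℝ} (hadd : ∀ s t, g (s + t) = g s + g t)
    (hpos : ∀ t, 0 < t → 0 < g t) (h1 : g 1 = 1) (t : ℝ) : g t = t := by
  have hmono : ∀ s t, s < t → g s < g t := fun s t h => by
    have := hpos (t - s) (by linarith)
    have h2 := hadd s (t - s)
    rw [add_sub_cancel] at h2
    linarith
  have hrat : ∀ q : ℚ, g q = q := fun q => by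
    have := map_rat_smul (AddMonoidHom.mk' g hadd) q (1 : ℝ)
    simpa [Rat.smul_def, h1] using this
  rcases lt_trichotomy (g t) t with h | h | h
  · obtain ⟨q, hq1, hq2⟩ := exists_rat_btwn h
    have := hmono _ _ hq2
    rw [hrat] at this
    linarith
  · exact h
  · obtain ⟨q, hq1, hq2⟩ := exists_rat_btwn h
    have := hmono _ _ hq1
    rw [hrat] at this
    linarith

namespace SyntheticGeometry
variable {E : Type*} {G : SyntheticGeometry E}

variable (G) in
/-- `f` is the affine parametrization of the line `PQ` with `f 0 = P` and `f 1 = Q`. -/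
structure IsParam (l : E → E → ℝ) (P Q : E) (f : ℝ → E) : Prop where
  zero : f 0 = P
  one : f 1 = Q
  mem_line : ∀ X, X ∈ G.line P Q ↔ ∃ t, f t = X
  dist : ∀ s t, l (f s) (f t) = |s - t| * l P Q
  btw : ∀ s t u, G.Btw (f s) (f t) (f u) ↔ (s < t ∧ t < u) ∨ (u < t ∧ t < s)

namespace IsLengthFunction
variable {I J : E} {l : E → E → ℝ}

theorem exists_param (hl : G.IsLengthFunction I J l) (hG : G.IsEuclidean) {P Q : E} (h : P ≠ Q) :
    ∃ f, G.IsParam l P Q f := by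
  obtain ⟨f, h0, h1, hm, hd, hb⟩ := hl.exists_ruler hG h
  have hp := hl.pos P Q h
  refine ⟨fun t => f (t * l P Q), ?_, ?_, fun X => ?_, fun s t => ?_, fun s t u => ?_⟩
  · simpa using h0
  · simpa using h1
  · rw [hm]
    exact ⟨fun ⟨t, ht⟩ => ⟨t / l P Q, by rwa [div_mul_cancel₀ _ hp.ne']⟩, fun ⟨t, ht⟩ => ⟨_, ht⟩⟩
  · rw [hd, ← sub_mul, abs_mul, abs_of_pos hp]
  · rw [hb]
    simp only [mul_lt_mul_iff_left₀ hp]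

end IsLengthFunction

namespace IsParam
variable {I J : E} {l : E → E → ℝ} {P Q : E} {f : ℝ → E}

theorem injective (hf : G.IsParam l P Q f) (hl : G.IsLengthFunction I J l) (h : P ≠ Q) :
    Function.Injective f := fun s t hst => by
  have := hf.dist s t
  rw [hst, hl.degenerate] at this
  rcases mul_eq_zero.1 this.symm with h' | h'
  · exact sub_eq_zero.1 (abs_eq_zero.1 h')
  · exact absurd h' (hl.pos _ _ h).ne'

theorem mem (hf : G.IsParam l P Q f) (t : ℝ) : f t ∈ G.line P Q := (hf.mem_line _).2 ⟨t, rfl⟩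

theorem reverse (hf : G.IsParam l P Q f) (hl : G.IsLengthFunction I J l) (hG : G.IsEuclidean) :
    G.IsParam l Q P fun t => f (1 - t) where
  zero := by simpa using hf.one
  one := by simpa using hf.zero
  mem_line X := by
    rw [line_comm, hf.mem_line]
    exact ⟨fun ⟨t, ht⟩ => ⟨1 - t, by rwa [sub_sub_cancel]⟩, fun ⟨t, ht⟩ => ⟨_, ht⟩⟩
  dist s t := by
    rw [hf.dist, hl.comm hG Q P, sub_sub_sub_cancel_left, abs_sub_comm]
  btw s t u := by
    rw [hf.btw]
    constructor <;> rintro (h | h) <;> [right; left; right; left] <;> constructor <;> linarith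

/-- A negative `s` reverses the order of parameters, which is harmless as betweenness is symmetric.
-/
theorem scale (hf : G.IsParam l P Q f) (hG : G.IsEuclidean) (hPQ : P ≠ Q) {s : ℝ}
    (h : P ≠ f s) :
    G.IsParam l P (f s) fun t => f (t * s) := by
  have hs : s ≠ 0 := by rintro rfl; exact h hf.zero.symm
  refine ⟨by simpa using hf.zero, by simp, fun X => ?_, fun t u => ?_, fun t u v => ?_⟩
  · rw [hG.line_eq (hG.line_mem hPQ) h (hG.left_mem_line _ _) (hf.mem s), hf.mem_line]
    exact ⟨fun ⟨t, ht⟩ => ⟨t / s, by rwa [div_mul_cancel₀ _ hs]⟩, fun ⟨t, ht⟩ => ⟨_, ht⟩⟩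
  · have := hf.dist 0 s
    rw [hf.zero, zero_sub, abs_neg] at this
    rw [hf.dist, ← sub_mul, abs_mul, this, mul_assoc]
  · rw [hf.btw]
    rcases hs.lt_or_gt with h | h
    · simp only [mul_lt_mul_right_of_neg h]
      tauto
    · simp only [mul_lt_mul_iff_left₀ h]

theorem mid (hf : G.IsParam l P Q f) {s t : ℝ} (h : s ≠ t) :
    G.Mid l (f s) (f ((s + t) / 2)) (f t) := by
  constructor
  · rw [hf.btw]
    rcases h.lt_or_gt with h | h
    · left; constructor <;> linarith
    · right; constructor <;> linarith
  · rw [hf.dist, hf.dist]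
    congr 2; ring

end IsParam

/-! ### Thales' theorem and parallelograms -/

namespace IsLengthFunction
variable {I J : E} {l : E → E → ℝ}

/-- The theorem of Thales: points dividing two sides of a triangle in the same ratio lie on a
parallel to the third side. -/
theorem thales (hl : G.IsLengthFunction I J l) (hG : G.IsEuclidean) {O X Y : E} {p q : ℝ → E}
    (h : ¬ G.Collin O X Y) (hp : G.IsParam l O X p) (hq : G.IsParam l O Y q) (t : ℝ) :
    ∃ m ∈ G.lines, G.Parallel m (G.line X Y) ∧ p t ∈ m ∧ q t ∈ m := by
  have n := hG.ne_of_not_collin h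
  obtain ⟨α, hα, hOα, hXα, hYα⟩ := hG.exists_plane_of_not_collin h
  have hpi := hp.injective hl n.1
  have hqi := hq.injective hl n.2.1
  have hm := hG.line_mem n.2.2
  have hXm := hG.left_mem_line X Y
  have hYm := hG.right_mem_line X Y
  have ha := hG.line_mem n.1
  have hOa := hG.left_mem_line O X
  have hXa := hG.right_mem_line O X
  have hb := hG.line_mem n.2.1
  have hOb := hG.left_mem_line O Y
  have hYb := hG.right_mem_line O Y
  have hYa : Y ∉ G.line O X := h
  have hXb : X ∉ G.line O Y := by grind
  have hOm : O ∉ G.line X Y := by grind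
  have hpa := hp.mem
  have hqb := hq.mem
  have hmα := hG.line_subset hα n.2.2 hXα hYα
  have haα := hG.line_subset hα n.1 hOα hXα
  have hbα := hG.line_subset hα n.2.1 hOα hYα
  have hpO : ∀ s, s ≠ 0 → p s ∉ G.line O Y := fun s hs hc => by
    have : p s ≠ O := fun h => hs (hpi (h.trans hp.zero.symm))
    grind
  have hqO : ∀ s, s ≠ 0 → q s ∉ G.line O X := fun s hs hc => by
    have : q s ≠ O := fun h => hs (hqi (h.trans hq.zero.symm))
    grind
  -- If the parallel missed `OY`, then `OY` and `XY` would be two parallels to it through `Y`.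
  have ex : ∀ s, ∃ m ∈ G.lines, p s ∈ m ∧ G.Parallel m (G.line X Y) ∧ ∃ t, q t ∈ m := by
    intro s
    obtain ⟨m, hml, hpm, hpar⟩ := hG.exists_parallel hm (p s)
    refine ⟨m, hml, hpm, hpar, ?_⟩
    by_contra! hc
    have hbm : G.Parallel (G.line O Y) m := Or.inr ⟨⟨α, hα, hbα,
      hG.parallel_subset hα hm hmα (haα (hpa s)) hpm hpar⟩, by
        ext Z
        simp only [Set.mem_inter_iff, Set.mem_empty_iff_false, iff_false, not_and]
        intro hZ hZm
        obtain ⟨t, rfl⟩ := (hq.mem_line Z).1 hZ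
        exact hc t hZm⟩
    have := hG.parallel_unique hml hb hm hYb hYm hbm hpar.symm
    exact hXb (this ▸ hXm)
  choose m hml hpm hpar g hgm using ex
  have hmα' : ∀ s, m s ⊆ α := fun s =>
    hG.parallel_subset hα hm hmα (haα (hpa s)) (hpm s) (hpar s)
  have hma : ∀ s, m s ≠ G.line O X := fun s hc => by
    have := (hpar s).eq_of_mem (hc ▸ hXa) hXm
    exact hYa (hc ▸ this ▸ hYm)
  have hmb : ∀ s, m s ≠ G.line O Y := fun s hc => by
    have := (hpar s).eq_of_mem (hc ▸ hYb) hYm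
    exact hXb (hc ▸ this ▸ hXm)
  have hpp : ∀ s t, G.Parallel (m s) (m t) := fun s t =>
    hG.parallel_trans hα (hml s) hm (hml t) (hmα' s) (hmα' t) (hpar s) (hpar t).symm
  -- a parallel to `XY` through `p s` meets `OY` exactly in `q (g s)`
  have huniq : ∀ s t m', m' ∈ G.lines → G.Parallel m' (G.line X Y) → p s ∈ m' → q t ∈ m' →
      g s = t := by
    intro s t m' hm' hpar' hp' hq'
    have := hG.parallel_unique hm (hml s) hm' (hpm s) hp' (hpar s) hpar'
    subst this
    apply hqi
    rcases hG.line_meet hm' hb hq' (hqb t) (hgm s) (hqb _) with h | h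
    · exact h.symm
    · exact absurd h (hmb s)
  have hg0 : g 0 = 0 := huniq 0 0 _ (hml 0) (hpar 0) (hpm 0) (by
    rw [hq.zero, ← hp.zero]; exact hpm 0)
  have hg1 : g 1 = 1 := huniq 1 1 _ hm (Or.inl rfl) (by rwa [hp.one]) (by rwa [hq.one])
  have hginj : ∀ s t, g s = g t → s = t := fun s t hst => by
    have h1 : m s = m t := (hpp s t).eq_of_mem (hgm s) (hst ▸ hgm t)
    by_contra hne
    have h2 := hpm t
    rw [← h1] at h2
    rcases hG.line_meet (hml s) ha (hpm s) (hpa s) h2 (hpa t) with h | h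
    · exact hne (hpi h)
    · exact hma s h
  have hgz : ∀ s, s ≠ 0 → g s ≠ 0 := fun s hs h => hs (hginj s 0 (h.trans hg0.symm))
  have line_m : ∀ s, s ≠ 0 → G.line (p s) (q (g s)) = m s := fun s hs =>
    hG.line_eq (hml s) (fun h => hpO s hs (h ▸ hqb _)) (hpm s) (hgm s)
  have jensen' : ∀ s t, s ≠ t → t ≠ 0 → g ((s + t) / 2) = (g s + g t) / 2 := by
    intro s t hst ht
    have hgst : g s ≠ g t := fun h => hst (hginj s t h)
    by_cases hs : s = 0
    · subst hs
      have hc : ¬ G.Collin O (p t) (q (g t)) := by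
        rintro ⟨d, hd, h1, h2, h3⟩
        have : p t ≠ O := fun h => ht (hpi (h.trans hp.zero.symm))
        have := hqO _ (hgz t ht)
        have := hpa t
        grind
      have M := hp.mid hst
      have N := hq.mid hgst
      rw [hg0] at N
      have hne : p ((0 + t) / 2) ≠ q ((0 + g t) / 2) := fun h' =>
        hpO ((0 + t) / 2) (by simpa using ht) (h' ▸ hqb _)
      rw [hp.zero] at M
      rw [hq.zero] at N
      have := hl.midline hG hc M N
      rw [line_m t ht] at this
      rw [hg0]
      exact huniq _ _ _ (hG.line_mem hne)
        (hG.parallel_trans hα (hG.line_mem hne) (hml t) hm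
          (hG.line_subset hα hne (haα (hpa _)) (hbα (hqb _))) hmα this (hpar t))
        (hG.left_mem_line _ _) (hG.right_mem_line _ _)
    · have hne1 : p s ≠ q (g t) := fun h => hpO s hs (h ▸ hqb _)
      -- `R` is the midpoint of a diagonal of the trapezoid cut out by `m s` and `m t`. The midlines
      -- of the two triangles pass through `R` and are parallel to `XY`, so they form one line
      -- joining the midpoints of the legs.
      obtain ⟨R, hR⟩ := hl.exists_mid hG hne1
      have M := hp.mid hst
      have N := hq.mid hgst
      have c1 : ¬ G.Collin (p s) (p t) (q (g t)) :=
        hG.not_collin ha (fun h => hst (hpi h)) (hpa s) (hpa t) (hqO _ (hgz t ht))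
      have c2 : ¬ G.Collin (q (g t)) (p s) (q (g s)) := fun hc =>
        hG.not_collin hb (fun h => hgst (hqi h)) (hqb _) (hqb _) (hpO s hs) hc.rotate.rotate
      have hRα := hG.mem_plane_mid hR.1 hα (haα (hpa _)) (hbα (hqb _))
      have p1 := hl.midline hG c1 M hR
      have p2 := hl.midline hG c2 (hl.mid_symm hG hR) (hl.mid_symm hG N)
      rw [line_m t ht] at p1
      rw [line_m s hs] at p2
      have nR := hG.btw_ne hR.1
      obtain ⟨d, hd, hd1, hdR, hd2⟩ := hG.btw_line hR.1
      have e1 : p ((s + t) / 2) ≠ R := fun h' => by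
        have h1 := hpa ((s + t) / 2)
        have h2 := hqO _ (hgz t ht)
        have h3 := hpa s
        rw [h'] at h1
        grind
      have e2 : R ≠ q ((g s + g t) / 2) := fun h' => by
        have h1 := hqb ((g s + g t) / 2)
        have h2 := hpO s hs
        have h3 := hqb (g t)
        rw [← h'] at h1
        grind
      have l1 := hG.line_mem e1
      have l2 := hG.line_mem e2
      have hMα := haα (hpa ((s + t) / 2))
      have hNα := hbα (hqb ((g s + g t) / 2))
      have p1' := hG.parallel_trans hα l1 (hml t) hm (hG.line_subset hα e1 hMα hRα) hmα p1 (hpar t)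
      have p2' := hG.parallel_trans hα l2 (hml s) hm (hG.line_subset hα e2 hRα hNα) hmα p2 (hpar s)
      have heq := hG.parallel_unique hm l1 l2 (hG.right_mem_line _ _) (hG.left_mem_line _ _) p1' p2'
      exact huniq _ _ _ l1 p1' (hG.left_mem_line _ _) (heq ▸ hG.right_mem_line _ _)
  have jensen : ∀ s t, s ≠ t → g ((s + t) / 2) = (g s + g t) / 2 := by
    intro s t hst
    by_cases ht : t = 0
    · have := jensen' t s hst.symm (fun h => hst (h.trans ht.symm))
      rw [add_comm s, this, add_comm]
    · exact jensen' s t hst ht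
  have half : ∀ s, g (s / 2) = g s / 2 := fun s => by
    by_cases hs : s = 0
    · simp [hs, hg0]
    · simpa [hg0] using jensen s 0 hs
  have hadd : ∀ s t, g (s + t) = g s + g t := fun s t => by
    by_cases hst : s = t
    · subst hst
      have := half (s + s)
      rw [add_self_div_two] at this
      linarith
    · have h1 := half (s + t)
      have h2 := jensen s t hst
      linarith
  -- The parallel `m 0` through `O` leaves `X` and `Y` on one side. For `s > 0` the points `p s` and
  -- `q (g s)` are on that side too, whereas a negative `g s` would put `O` between `q (g s)` and
  -- `Y`.
  have hpos : ∀ s, 0 < s → 0 < g s := by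
    intro s hs
    have hO0 : O ∈ m 0 := hp.zero ▸ hpm 0
    have hX0 : X ∉ m 0 := fun hc => hOm ((hpar 0).eq_of_mem hc hXm ▸ hO0)
    have hY0 : Y ∉ m 0 := fun hc => hOm ((hpar 0).eq_of_mem hc hYm ▸ hO0)
    have hray : p s ∈ G.ray O X := (hG.mem_ray_iff n.1).2 ⟨hpa s, by
      have := (hp.btw s 0 1)
      rw [hp.zero, hp.one] at this
      rw [this]
      rintro (h | h) <;> linarith⟩
    have h1 := hG.not_separates_ray (hml 0) hO0 hX0 hray
      (fun h => hs.ne' (hpi (h.trans hp.zero.symm)))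
    have h2 : ¬ G.Separates (m 0) X Y := fun ⟨Z, hZ, hXZ⟩ =>
      hOm ((hpar 0).eq_of_mem hZ (hG.mem_mid hXZ hm hXm hYm) ▸ hO0)
    have h3 : q (g s) ∉ m 0 := fun hc => h1.1 ((hpp s 0).eq_of_mem (hgm s) hc ▸ hpm s)
    have h4 : ¬ G.Separates (m 0) (q (g s)) (p s) := fun ⟨Z, hZ, hXZ⟩ =>
      h1.1 ((hpp s 0).eq_of_mem (hG.mem_mid hXZ (hml s) (hgm s) (hpm s)) hZ ▸ hpm s)
    have hqα := hbα (hqb (g s))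
    have h5 := hG.not_separates_trans hα (hml 0) (hmα' 0) hqα (haα (hpa s)) hYα h3 h1.1 hY0 h4
      (hG.not_separates_trans hα (hml 0) (hmα' 0) (haα (hpa s)) hXα hYα h1.1 hX0 hY0 h1.2 h2)
    by_contra hc
    have := (hq.btw (g s) 0 1).2 (Or.inl ⟨lt_of_le_of_ne (not_lt.1 hc) (hgz s hs.ne'), one_pos⟩)
    rw [hq.zero, hq.one] at this
    exact h5 ⟨O, hO0, this⟩
  refine ⟨m t, hml t, hpar t, hpm t, ?_⟩
  have := hgm t
  rwa [eq_id_of_add_of_pos hadd hpos hg1 t] at this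

/-- Opposite sides of a parallelogram are congruent. -/
theorem parallelogram (hl : G.IsLengthFunction I J l) (hG : G.IsEuclidean) {A B C D : E}
    {a b c d : Set E} (ha : a ∈ G.lines) (hb : b ∈ G.lines) (hc : c ∈ G.lines) (hd : d ∈ G.lines)
    (hac : G.Parallel a c) (hbd : G.Parallel b d) (hAa : A ∈ a) (hAd : A ∈ d) (hBa : B ∈ a)
    (hBb : B ∈ b) (hCb : C ∈ b) (hCc : C ∈ c) (hDc : D ∈ c) (hDd : D ∈ d) (hCa : C ∉ a)
    (hAb : A ∉ b) : l A B = l C D := by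
  have hAC : A ≠ C := fun h => hCa (h ▸ hAa)
  obtain ⟨M, hM⟩ := hl.exists_mid hG hAC
  obtain ⟨e, he, heA, heM, heC⟩ := hG.btw_line hM.1
  have nM := hG.btw_ne hM.1
  have hMa : M ∉ a := by grind
  have hMb : M ∉ b := by grind
  have hBM : B ≠ M := fun h => hMa (h ▸ hBa)
  have hAB : A ≠ B := fun h => hAb (h ▸ hBb)
  -- The reflection in the midpoint of the diagonal `AC` exchanges `a` with `c` and `b` with `d`, so
  -- it takes `B` to the common point `D` of `c` and `d`.
  obtain ⟨W, hW⟩ := hl.exists_reflection hG hBM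
  have h1 := hl.reflection_mem_parallel hG ha hc hac hMa hAa hCc hM hBa hW
  have h2 := hl.reflection_mem_parallel hG hb hd hbd hMb hCb hAd (hl.mid_symm hG hM) hBb hW
  have hcd : c ≠ d := by
    rintro rfl
    exact hCa (hac.eq_of_mem hAa hAd ▸ hCc)
  have hWD : W = D := by grind
  have hcol : ¬ G.Collin A M B := fun hcol =>
    hG.not_collin ha hAB hAa hBa hMa hcol.rev.rotate.rotate
  rw [← hWD]
  exact (hl.reflection_congr hG hcol hM hW).1.symm

/-- In the situation of the theorem of Thales, the cut off segment is proportional to the third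
side. -/
theorem thales_length (hl : G.IsLengthFunction I J l) (hG : G.IsEuclidean) {O X Y : E}
    {p q : ℝ → E} (h : ¬ G.Collin O X Y) (hp : G.IsParam l O X p) (hq : G.IsParam l O Y q)
    {t : ℝ} (ht : t ≠ 0) : l (p t) (q t) = |t| * l X Y := by
  by_cases h1 : t = 1
  · rw [h1, hp.one, hq.one, abs_one, one_mul]
  have n := hG.ne_of_not_collin h
  obtain ⟨r, hr⟩ := hl.exists_param hG n.2.2
  obtain ⟨m, hm, hpar, hpm, hqm⟩ := hl.thales hG h hp hq t
  -- Thales from the vertex `X`, where `p t` has parameter `1 - t`: the parallel to `OY` through `p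
  -- t` meets `XY` at `r (1 - t)`. With `q t` and `Y` this makes a parallelogram whose side on `XY`
  -- has length `|t|` times that of `XY`.
  obtain ⟨m', hm', hpar', hpm', hrm'⟩ := hl.thales hG (fun hc => h hc.swap) (hp.reverse hl hG) hr
    (1 - t)
  simp only [sub_sub_cancel] at hpm'
  have hpi := hp.injective hl n.1
  have hpa := hp.mem t
  have ha := hG.line_mem n.1
  have hOa := hG.left_mem_line O X
  have hXa := hG.right_mem_line O X
  have hb := hG.line_mem n.2.1
  have hOb := hG.left_mem_line O Y
  have hYb := hG.right_mem_line O Y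
  have hc := hG.line_mem n.2.2
  have hXc := hG.left_mem_line X Y
  have hYc := hG.right_mem_line X Y
  have hYa : Y ∉ G.line O X := h
  have hpO : p t ≠ O := fun h => ht (hpi (h.trans hp.zero.symm))
  have hpX : p t ≠ X := fun h => h1 (hpi (h.trans hp.one.symm))
  have hpb : p t ∉ G.line O Y := by grind
  have hpc : p t ∉ G.line X Y := by grind
  have hYm : Y ∉ m := fun hc => hpc (hpar.eq_of_mem hc hYc ▸ hpm)
  have key := hl.parallelogram hG hm hb hc hm' hpar hpar'.symm hpm hpm' hqm (hq.mem t) hYb hYc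
    (hr.mem (1 - t)) hrm' hYm hpb
  rw [key]
  have := hr.dist 1 (1 - t)
  rwa [hr.one, sub_sub_cancel] at this

end IsLengthFunction
end SyntheticGeometry

/-! ### Homotheties as multiplication of parameters -/

namespace SyntheticGeometry
variable {E : Type*} {G : SyntheticGeometry E} {I J : E}

namespace IsEuclidean

theorem isLengthFunction_length (hG : G.IsEuclidean) (hIJ : I ≠ J) :
    G.IsLengthFunction I J (G.length I J) :=
  Classical.epsilon_spec (hG.exists_isLengthFunction hIJ)

/-- The length condition determines the parameter up to sign, and the ray or betweenness condition
fixes the sign. Existence and uniqueness together make the choice in `homothety` determinate. -/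
theorem isScalarMul_iff (hG : G.IsEuclidean) (hIJ : I ≠ J) {O X : E} (h : O ≠ X) {f : ℝ → E}
    (hf : G.IsParam (G.length I J) O X f) (k : ℝ) {Y : E} :
    G.IsScalarMul I J k O X Y ↔ Y = f k := by
  have hl := hG.isLengthFunction_length hIJ
  have hp := hl.pos O X h
  have b1 := fun t => hf.btw t 0 1
  have b2 := fun t => hf.btw 1 0 t
  simp only [hf.zero, hf.one] at b1 b2
  have hd : ∀ t, G.length I J O (f t) = |t| * G.length I J O X := fun t => by
    have := hf.dist 0 t
    rwa [hf.zero, zero_sub, abs_neg] at this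
  constructor
  · rintro ⟨h1, h2, h3, h4, h5⟩
    obtain ⟨t, rfl⟩ := (hf.mem_line Y).1 h1
    rw [hd] at h2
    have habs : |t| = |k| := mul_right_cancel₀ hp.ne' h2
    rcases abs_eq_abs.1 habs with rfl | rfl
    · rfl
    · rcases lt_trichotomy k 0 with hk | rfl | hk
      · rcases (b2 (-k)).1 (h4 hk) with h | h <;> linarith
      · rw [neg_zero]
      · exact absurd ((b1 (-k)).2 (Or.inl ⟨by linarith, one_pos⟩))
          ((hG.mem_ray_iff h).1 (h3 hk)).2
  · rintro rfl
    refine ⟨hf.mem k, hd k, fun hk => (hG.mem_ray_iff h).2 ⟨hf.mem k, ?_⟩, fun hk => ?_, ?_⟩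
    · rw [b1]
      rintro (h | h) <;> linarith
    · exact (b2 k).2 (Or.inr ⟨hk, one_pos⟩)
    · rintro rfl; exact hf.zero

theorem homothety_center (O : E) (k : ℝ) : G.homothety I J k O O = O := if_pos rfl

theorem homothety_eq (hG : G.IsEuclidean) (hIJ : I ≠ J) {O X : E} (h : O ≠ X) {f : ℝ → E}
    (hf : G.IsParam (G.length I J) O X f) (k : ℝ) : G.homothety I J k O X = f k := by
  rw [homothety, if_neg h.symm, ← hG.isScalarMul_iff hIJ h hf]
  exact @Classical.epsilon_spec E (fun Y => G.IsScalarMul I J k O X Y)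
    ⟨f k, (hG.isScalarMul_iff hIJ h hf k).2 rfl⟩

/-- One parametrization serves all points of the line: away from the centre, `IsParam.scale` moves
the unit point to `f s`. -/
theorem homothety_collin (hG : G.IsEuclidean) (hIJ : I ≠ J) {O X : E} (h : O ≠ X) {f : ℝ → E}
    (hf : G.IsParam (G.length I J) O X f) (k s : ℝ) : G.homothety I J k O (f s) = f (k * s) := by
  by_cases hs : O = f s
  · have : s = 0 := hf.injective (hG.isLengthFunction_length hIJ) h (hs.symm.trans hf.zero.symm)
    rw [← hs, homothety_center, this, mul_zero, hf.zero]
  · exact hG.homothety_eq hIJ hs (hf.scale hG h hs) k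

/-- A homothety with centre on the line `XY` preserves this line and scales the length of `XY`. -/
theorem homothety_similar_of_collin (hG : G.IsEuclidean) (hIJ : I ≠ J) {O X Y : E}
    (h : G.Collin O X Y) (k : ℝ) :
    G.length I J (G.homothety I J k O X) (G.homothety I J k O Y) = |k| * G.length I J X Y ∧
      (k ≠ 0 → X ≠ Y →
        G.homothety I J k O X ≠ G.homothety I J k O Y ∧
        G.Parallel (G.line (G.homothety I J k O X) (G.homothety I J k O Y)) (G.line X Y)) := by
  have hl := hG.isLengthFunction_length hIJ
  obtain ⟨a, ha, hO, hX, hY⟩ := h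
  obtain ⟨A, hA, hOA⟩ : ∃ A ∈ a, O ≠ A := by
    obtain ⟨K, L, h, hK, hL⟩ := hG.line_two_points a ha
    by_cases h1 : O = K
    · exact ⟨L, hL, h1 ▸ h⟩
    · exact ⟨K, hK, h1⟩
  obtain ⟨f, hf⟩ := hl.exists_param hG hOA
  have hline := hG.line_eq ha hOA hO hA
  have hfa : ∀ t, f t ∈ a := fun t => hline ▸ hf.mem t
  obtain ⟨s, rfl⟩ := (hf.mem_line X).1 (hline ▸ hX)
  obtain ⟨t, rfl⟩ := (hf.mem_line Y).1 (hline ▸ hY)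
  rw [hG.homothety_collin hIJ hOA hf, hG.homothety_collin hIJ hOA hf]
  refine ⟨by rw [hf.dist, hf.dist, ← mul_sub, abs_mul, mul_assoc], fun hk hne => ?_⟩
  have hne' : f (k * s) ≠ f (k * t) := fun h =>
    hne (congrArg f (mul_left_cancel₀ hk (hf.injective hl hOA h)))
  exact ⟨hne', Or.inl ((hG.line_eq ha hne' (hfa _) (hfa _)).trans
    (hG.line_eq ha hne (hfa _) (hfa _)).symm)⟩

theorem homothety_similar_of_not_collin (hG : G.IsEuclidean) (hIJ : I ≠ J) {O X Y : E}
    (h : ¬ G.Collin O X Y) (k : ℝ) :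
    G.length I J (G.homothety I J k O X) (G.homothety I J k O Y) = |k| * G.length I J X Y ∧
      (k ≠ 0 → X ≠ Y →
        G.homothety I J k O X ≠ G.homothety I J k O Y ∧
        G.Parallel (G.line (G.homothety I J k O X) (G.homothety I J k O Y)) (G.line X Y)) := by
  have hl := hG.isLengthFunction_length hIJ
  have n := hG.ne_of_not_collin h
  obtain ⟨p, hp⟩ := hl.exists_param hG n.1
  obtain ⟨q, hq⟩ := hl.exists_param hG n.2.1
  rw [hG.homothety_eq hIJ n.1 hp, hG.homothety_eq hIJ n.2.1 hq]
  by_cases hk : k = 0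
  · subst hk
    refine ⟨?_, fun h => absurd rfl h⟩
    rw [hp.zero, hq.zero, hl.degenerate, abs_zero, zero_mul]
  · have hlen := hl.thales_length hG h hp hq hk
    refine ⟨hlen, fun _ hXY => ?_⟩
    have hne : p k ≠ q k := fun h' => by
      rw [h', hl.degenerate] at hlen
      exact (mul_pos (abs_pos.2 hk) (hl.pos _ _ hXY)).ne hlen
    obtain ⟨m, hm, hpar, h1, h2⟩ := hl.thales hG h hp hq k
    exact ⟨hne, by rwa [hG.line_eq hm hne h1 h2]⟩

end IsEuclidean
end SyntheticGeometry

theorem theorem11p1 {E : Type*} (G : SyntheticGeometry E) (hG : G.IsEuclidean)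
    (I J : E) (hIJ : I ≠ J) (O : E) (k : ℝ) (X Y : E) :
    G.length I J (G.homothety I J k O X) (G.homothety I J k O Y) = |k| * G.length I J X Y ∧
      (k ≠ 0 → X ≠ Y →
        G.homothety I J k O X ≠ G.homothety I J k O Y ∧
        G.Parallel (G.line (G.homothety I J k O X) (G.homothety I J k O Y)) (G.line X Y)) := by
  by_cases h : G.Collin O X Y
  · exact hG.homothety_similar_of_collin hIJ h k
  · exact hG.homothety_similar_of_not_collin hIJ h k
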